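/- Let $\mathbb F_q$ be a finite field with $q$ elements, let $n\ge 0$, and let $D\subseteq\{(i,j): 1\le i<j\le n\}$ be closed, meaning that $(i,j),(j,k)\in D$ implies $(i,k)\in D$. Let $\mathfrak a$ be the pattern algebra of all $n\times n$ matrices $X$ over $\mathbb F_q$ such that $X_{ij}=0$ for all $(i,j)\notin D$, and let $G=1+\mathfrak a\le \mathrm{GL}_n(\mathbb F_q)$ be the corresponding pattern group. Let $G$ act on the linear dual $\mathfrak a^*$ by the coadjoint action $(\mathrm{Ad}^*(g)T)(X)=T(g^{-1}Xg)$ for $g\in G$, $T\in\mathfrak a^*$, $X\in\mathfrak a$. Then the number of irreducible complex characters of $G$ of degree $q$ equals the number of coadjoint orbits in $\mathfrak a^*$ of cardinality $q^2$. -/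

import Mathlib

/-- A closed set `D` of positive roots of `GL_n`. The pair `(i, j)` stands for the root
`ε_i - ε_j`; it is positive when `i < j`, and the sum of `(i, j)` and `(k, l)` is a positive root
exactly when `j = k` or `l = i`. -/
structure ClosedRootSet (n : ℕ) where
  carrier : Set (Fin n × Fin n)
  lt_of_mem : ∀ {i j : Fin n}, (i, j) ∈ carrier → i < j
  closed : ∀ {i j k : Fin n}, (i, j) ∈ carrier → (j, k) ∈ carrier → (i, k) ∈ carrier

/-- The pattern algebra `𝔤_D`: the matrices supported on the positions in `D`. -/
def patternAlgebra {n : ℕ} (F : Type*) [Field F] (D : ClosedRootSet n) :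
    NonUnitalSubalgebra F (Matrix (Fin n) (Fin n) F) where
  carrier := {X | ∀ i j, X i j ≠ 0 → (i, j) ∈ D.carrier}
  zero_mem' := fun i j h => absurd rfl h
  add_mem' := by
    intro X Y hX hY i j h
    by_cases h0 : X i j = 0
    · exact hY i j (by simpa [h0] using h)
    · exact hX i j h0
  smul_mem' := by
    intro c X hX i j h
    exact hX i j (fun h0 => h (by simp [h0]))
  mul_mem' := by
    intro X Y hX hY i j h
    rw [Matrix.mul_apply] at h
    obtain ⟨k, -, hk⟩ := Finset.exists_ne_zero_of_sum_ne_zero h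
    exact D.closed (hX i k (left_ne_zero_of_mul hk)) (hY k j (right_ne_zero_of_mul hk))

/-- The pattern group `1 + 𝔤_D`, as a subgroup of `GL_n(F)`. -/
def patternGroup {n : ℕ} (F : Type*) [Field F] (D : ClosedRootSet n) :
    Subgroup (Matrix.GeneralLinearGroup (Fin n) F) where
  carrier := {g | (g : Matrix (Fin n) (Fin n) F) - 1 ∈ patternAlgebra F D}
  one_mem' := by simp [zero_mem]
  mul_mem' := by
    intro g h hg hh
    have e : ((g * h : Matrix.GeneralLinearGroup (Fin n) F) : Matrix (Fin n) (Fin n) F) - 1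
        = ((g : Matrix (Fin n) (Fin n) F) - 1) * ((h : Matrix (Fin n) (Fin n) F) - 1)
          + ((g : Matrix (Fin n) (Fin n) F) - 1) + ((h : Matrix (Fin n) (Fin n) F) - 1) := by
      rw [Units.val_mul]; noncomm_ring
    change _ ∈ patternAlgebra F D
    rw [e]
    exact add_mem (add_mem (mul_mem hg hh) hg) hh
  inv_mem' := by
    intro g hg
    set x := (g : Matrix (Fin n) (Fin n) F) - 1 with hx
    set y := ((g⁻¹ : Matrix.GeneralLinearGroup (Fin n) F) : Matrix (Fin n) (Fin n) F) - 1 with hy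
    have hg' : x ∈ patternAlgebra F D := hg
    change y ∈ patternAlgebra F D
    have e : y = -x - x * y := by
      have h1 : (x + 1) * (y + 1) = 1 := by
        rw [hx, hy, sub_add_cancel, sub_add_cancel]
        exact g.mul_inv
      have h2 : (x + 1) * (y + 1) = x * y + x + y + 1 := by noncomm_ring
      have h3 : x * y + x + y = 0 := by
        rw [h2] at h1
        exact add_eq_right.mp h1
      have h4 : y = (x * y + x + y) - x - x * y := by abel
      rw [h3] at h4
      rw [zero_sub] at h4
      exact h4
    have key : ∀ i j, y i j ≠ 0 → (i, j) ∈ D.carrier := by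
      intro i
      induction i using WellFoundedGT.induction with
      | ind i ih =>
        intro j hij
        by_contra hD
        have hxij : x i j = 0 := by
          by_contra h0
          exact hD (hg' i j h0)
        have e' := congrFun (congrFun e i) j
        rw [Matrix.sub_apply, Matrix.neg_apply, hxij, Matrix.mul_apply, neg_zero, zero_sub] at e'
        rw [e'] at hij
        obtain ⟨k, -, hk⟩ := Finset.exists_ne_zero_of_sum_ne_zero (neg_ne_zero.mp hij)
        have hik := hg' i k (left_ne_zero_of_mul hk)
        exact hD (D.closed hik (ih k (D.lt_of_mem hik) j (right_ne_zero_of_mul hk)))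
    exact key

theorem patternGroup_conj_mem {n : ℕ} {F : Type*} [Field F] {D : ClosedRootSet n}
    (g : patternGroup F D) (X : patternAlgebra F D) :
    (g.1 : Matrix (Fin n) (Fin n) F) * (X : Matrix (Fin n) (Fin n) F)
      * ((g⁻¹).1 : Matrix (Fin n) (Fin n) F) ∈ patternAlgebra F D := by
  have hl : ∀ (h : patternGroup F D) (Y : Matrix (Fin n) (Fin n) F), Y ∈ patternAlgebra F D →
      (h.1 : Matrix (Fin n) (Fin n) F) * Y ∈ patternAlgebra F D := by
    intro h Y hY
    have hh : (h.1 : Matrix (Fin n) (Fin n) F) - 1 ∈ patternAlgebra F D := h.2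
    have e : (h.1 : Matrix (Fin n) (Fin n) F) * Y
        = ((h.1 : Matrix (Fin n) (Fin n) F) - 1) * Y + Y := by noncomm_ring
    rw [e]
    exact add_mem (mul_mem hh hY) hY
  have hr : ∀ (h : patternGroup F D) (Y : Matrix (Fin n) (Fin n) F), Y ∈ patternAlgebra F D →
      Y * (h.1 : Matrix (Fin n) (Fin n) F) ∈ patternAlgebra F D := by
    intro h Y hY
    have hh : (h.1 : Matrix (Fin n) (Fin n) F) - 1 ∈ patternAlgebra F D := h.2
    have e : Y * (h.1 : Matrix (Fin n) (Fin n) F)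
        = Y * ((h.1 : Matrix (Fin n) (Fin n) F) - 1) + Y := by noncomm_ring
    rw [e]
    exact add_mem (mul_mem hY hh) hY
  exact hr g⁻¹ _ (hl g _ X.2)

/-- The adjoint action of the pattern group on its pattern algebra, `Ad(g) X = g X g⁻¹`. -/
def adjointRep {n : ℕ} (F : Type*) [Field F] (D : ClosedRootSet n) :
    Representation F (patternGroup F D) (patternAlgebra F D) where
  toFun g :=
    { toFun := fun X => ⟨_, patternGroup_conj_mem g X⟩
      map_add' := fun X Y => Subtype.ext (by simp [mul_add, add_mul])
      map_smul' := fun c X => Subtype.ext (by simp) }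
  map_one' := LinearMap.ext fun X => Subtype.ext (by simp)
  map_mul' g h := LinearMap.ext fun X => Subtype.ext (by simp [mul_assoc])

/-- The coadjoint action on the linear dual, `(Ad*(g) T)(X) = T(Ad(g⁻¹) X)`. -/
noncomputable def coadjointRep {n : ℕ} (F : Type*) [Field F] (D : ClosedRootSet n) :
    Representation F (patternGroup F D) (Module.Dual F (patternAlgebra F D)) :=
  (adjointRep F D).dual

theorem coadjointRep_apply {n : ℕ} (F : Type*) [Field F] (D : ClosedRootSet n)
    (g : patternGroup F D) (T : Module.Dual F (patternAlgebra F D)) (X : patternAlgebra F D) :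
    coadjointRep F D g T X = T (adjointRep F D g⁻¹ X) := rfl

/-- The coadjoint orbit of `T`. -/
def coadjointOrbit {n : ℕ} {F : Type*} [Field F] {D : ClosedRootSet n}
    (T : Module.Dual F (patternAlgebra F D)) : Set (Module.Dual F (patternAlgebra F D)) :=
  Set.range fun g : patternGroup F D => coadjointRep F D g T

/-- `χ` is the character of a finite-dimensional irreducible complex representation of `G`. -/
def IsIrreducibleCharacter {G : Type*} [Group G] (χ : G → ℂ) : Prop :=
  ∃ (V : Type) (_ : AddCommGroup V) (_ : Module ℂ V) (_ : FiniteDimensional ℂ V)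
    (ρ : Representation ℂ G V), ρ.IsIrreducible ∧ ρ.character = χ

/-! Write `𝔞` for the pattern algebra, with square `𝔞²` and cube `𝔞³`. Both counts only involve data
trivial on `𝔞³`, where the group looks like one of class two and a direct form of the orbit method
works in every characteristic, with no exponential map.

Reduction to the cube. If an irreducible representation is nontrivial on some `1 + c E_il` with
`(i,l) = (i,j) + (j,k) + (k,l)`, it restricts to a Heisenberg group of order `q^5` with nontrivial
centre, so its degree is at least `q²` (`card_sq_le_finrank_of_heisenberg`). On the dual side, if
`T(E_il) ≠ 0`, then `Y ↦ T([·,Y])` takes at least `q³` values, so the orbit has more than `q²`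
elements (`apply_eq_zero_of_encard_coadjointOrbit`).

Now let `T` vanish on `𝔞³`, and let `R` be the radical of `T([X,Y])`. It contains `𝔞²` and depends
only on `T` restricted to `𝔞²`. The orbit of `T` is the coset of the annihilator of `R` through `T`,
so it has `|𝔞|/|R|` elements and is determined by `T` restricted to `R`. An irreducible character
acting on `1 + 𝔞²` through `ψ ∘ T` vanishes exactly off `1 + R`, so its degree squared is `|𝔞|/|R|`.
Such characters exist (`exists_liesOver`), and any two differ by a twist by `ψ ∘ S` with `S` zero on
`𝔞²`, where only `S` restricted to `R` matters (`LiesOver.exists_twist_eq`,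
`LiesOver.twist_eq_twist_iff`).

Thus over each functional on `𝔞²` the characters and the orbits are torsors under the same group,
the dual of `R/𝔞²`, and degree `q` corresponds to orbit size `q²`. The matching is not canonical: it
uses a base character over each functional. -/

open Module

/-! ### Irreducible representations, Schur's lemma and twists -/

section Representations

variable {G : Type*} [Group G]

/-- A nonzero finite-dimensional subrepresentation contains an irreducible one. -/
theorem Subrepresentation.exists_le_isIrreducible {k V : Type*} [Field k] [AddCommGroup V]
    [Module k V] [FiniteDimensional k V] {ρ : Representation k G V} (W : Subrepresentation ρ)
    (hW : W ≠ ⊥) : ∃ U ≤ W, U.toRepresentation.IsIrreducible := by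
  have hwf : WellFounded fun A B : Subrepresentation ρ =>
      finrank k A.toSubmodule < finrank k B.toSubmodule :=
    InvImage.wf (fun A : Subrepresentation ρ => finrank k A.toSubmodule) wellFounded_lt
  obtain ⟨U, ⟨hUW, hU⟩, hmin⟩ := hwf.has_min {U | U ≤ W ∧ U ≠ ⊥} ⟨W, le_rfl, hW⟩
  refine ⟨U, hUW, ?_⟩
  have hne : ∃ x : U.toSubmodule, x ≠ 0 := by
    by_contra! h
    refine hU (le_antisymm (fun x hx => ?_) bot_le)
    have := h ⟨x, hx⟩
    exact (Submodule.mem_bot k).2 (congrArg Subtype.val this)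
  refine { exists_pair_ne := ⟨⊥, ⊤, fun h => ?_⟩, eq_bot_or_eq_top := fun S => ?_ }
  · obtain ⟨x, hx⟩ := hne
    have hx' : x ∈ (⊥ : Subrepresentation U.toRepresentation) := by
      rw [h]; exact Submodule.mem_top
    exact hx ((Submodule.mem_bot k).1 hx')
  · let S' : Subrepresentation ρ :=
      { toSubmodule := S.toSubmodule.map U.toSubmodule.subtype
        apply_mem_toSubmodule := by
          rintro g _ ⟨x, hx, rfl⟩
          exact ⟨U.toRepresentation g x, S.apply_mem_toSubmodule g hx, rfl⟩ }
    have hS'U : S'.toSubmodule ≤ U.toSubmodule := Submodule.map_subtype_le _ _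
    by_cases hS : S' = ⊥
    · left
      refine le_antisymm (fun x hx => ?_) bot_le
      have : (x : V) ∈ S' := ⟨x, hx, rfl⟩
      rw [hS] at this
      exact (Submodule.mem_bot k).2 (Subtype.ext ((Submodule.mem_bot k).1 this))
    · right
      have hle := hmin S' ⟨fun x hx => hUW (hS'U hx), hS⟩
      have heq : S'.toSubmodule = U.toSubmodule :=
        Submodule.eq_of_le_of_finrank_le hS'U (not_lt.1 hle)
      refine le_antisymm le_top (fun x _ => ?_)
      have hx : (x : V) ∈ S'.toSubmodule := by rw [heq]; exact x.2
      obtain ⟨y, hy, hyx⟩ := hx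
      rwa [← Subtype.ext hyx]

variable {V : Type*} [AddCommGroup V] [Module ℂ V]
  (ρ : Representation ℂ G V)

theorem Representation.sum_character_mul_character_inv [FiniteDimensional ℂ V] [Fintype G] (hρ : ρ.IsIrreducible) :
    ∑ g, ρ.character g * ρ.character g⁻¹ = Nat.card G := by
  have h0 : (Nat.card G : ℂ) ≠ 0 := by exact_mod_cast Nat.card_pos.ne'
  let _ : Invertible (Nat.card G : ℂ) := invertibleOfNonzero h0
  have h := ρ.card_inv_mul_sum_char_mul_char_eq_finrank ρ
  rw [Representation.IsIrreducible.finrank_intertwiningMap_self, Nat.cast_one,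
    inv_mul_eq_one₀ h0] at h
  exact h.symm

/-- Schur's lemma for a group element acting centrally. -/
theorem Representation.exists_eq_smul_one_of_commute [FiniteDimensional ℂ V] (hρ : ρ.IsIrreducible) (g : G)
    (hg : ∀ h, ρ g * ρ h = ρ h * ρ g) : ∃ c : ℂ, ρ g = c • 1 := by
  let f : Representation.IntertwiningMap ρ ρ := ⟨ρ g, fun h => hg h⟩
  obtain ⟨c, hc⟩ :=
    (Representation.IsIrreducible.algebraMap_intertwiningMap_bijective_of_isAlgClosed
      (ρ := ρ)).2 f
  refine ⟨c, ?_⟩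
  have := congrArg Representation.IntertwiningMap.toLinearMap hc
  exact this.symm

/-- The hypothesis makes `ρ g` equal to `c` times a conjugate of itself, so its trace is fixed by
multiplication by `c ≠ 1`. -/
theorem Representation.character_eq_zero_of_mul_eq_smul (g h : G) (c : ℂ) (hc : c ≠ 1)
    (hgh : ρ g * ρ h = c • (ρ h * ρ g)) : ρ.character g = 0 := by
  have h1 : ρ.character g = c * ρ.character g := by
    have e : ρ (g * h * h⁻¹) = c • ρ (h * g * h⁻¹) := by
      rw [map_mul, map_mul, hgh, smul_mul_assoc, map_mul, map_mul]
    rw [mul_inv_cancel_right] at e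
    conv_lhs => rw [Representation.character, e, map_smul, smul_eq_mul]
    rw [← ρ.char_conj g h, Representation.character]
  have h2 : (c - 1) * ρ.character g = 0 := by linear_combination -h1
  exact (mul_eq_zero.1 h2).resolve_left (sub_ne_zero.2 hc)

/-- The twist of a representation by a linear character. -/
def Representation.twist (θ : G →* ℂ) : Representation ℂ G V where
  toFun g := θ g • ρ g
  map_one' := by simp
  map_mul' g h := by simp [smul_smul, mul_comm]

theorem Representation.twist_apply (θ : G →* ℂ) (g : G) : ρ.twist θ g = θ g • ρ g := rfl

theorem Representation.character_twist (θ : G →* ℂ) (g : G) :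
    (ρ.twist θ).character g = θ g * ρ.character g := by
  simp [Representation.character, Representation.twist_apply]

theorem Representation.twist_isIrreducible (θ : G →* ℂ) (hρ : ρ.IsIrreducible) :
    (ρ.twist θ).IsIrreducible := by
  have hθ (g : G) : θ g ≠ 0 := ((Group.isUnit g).map θ).ne_zero
  let e : Subrepresentation ρ ≃o Subrepresentation (ρ.twist θ) :=
    { toFun := fun U => ⟨U.toSubmodule, fun g v hv =>
        U.toSubmodule.smul_mem (θ g) (U.apply_mem_toSubmodule g hv)⟩
      invFun := fun U => ⟨U.toSubmodule, fun g v hv =>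
        (U.toSubmodule.smul_mem_iff (hθ g)).1 (U.apply_mem_toSubmodule g hv)⟩
      left_inv := fun U => rfl
      right_inv := fun U => rfl
      map_rel_iff' := Iff.rfl }
  exact e.isSimpleOrder_iff.1 hρ

theorem Representation.character_one_ne_zero [FiniteDimensional ℂ V] (hρ : ρ.IsIrreducible) : ρ.character 1 ≠ 0 := by
  rw [Representation.char_one]
  intro h
  have h0 : finrank ℂ V = 0 := by exact_mod_cast h
  have := Module.finrank_zero_iff.1 h0
  obtain ⟨U, W, hUW⟩ := hρ.exists_pair_ne
  exact hUW (Subrepresentation.toSubmodule_injective (Subsingleton.elim _ _))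

end Representations

/-! ### Additive characters and the Heisenberg bound -/

section AdditiveCharacters

/-- Every complex character of a finite vector space factors through a linear functional. -/
theorem AddChar.exists_linear_of_isPrimitive {F : Type*} [Field F] [Finite F] {V : Type*}
    [AddCommGroup V] [Module F V] [Finite V] {ψ : AddChar F ℂ} (hψ : ψ.IsPrimitive)
    (φ : AddChar V ℂ) : ∃ τ : Dual F V, ∀ x, φ x = ψ (τ x) := by
  have _ := Fintype.ofFinite V
  have _ := Fintype.ofFinite F
  have : FiniteDimensional F V := Module.Finite.of_finite
  have hfin : Finite (Dual F V) := Finite.of_injective _ DFunLike.coe_injective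
  have _ := Fintype.ofFinite (Dual F V)
  let f : Dual F V → AddChar V ℂ := fun τ => ψ.compAddMonoidHom τ.toAddMonoidHom
  -- Primitivity makes the map from functionals to characters injective; both sides have `|V|`
  -- elements, so it is bijective.
  have hf : Function.Injective f := by
    intro σ τ h
    ext x
    by_contra hx
    refine hψ (sub_ne_zero.2 hx) (DFunLike.ext _ _ fun c => ?_)
    have h1 : ψ (σ (c • x)) = ψ (τ (c • x)) := DFunLike.congr_fun h (c • x)
    rw [AddChar.mulShift_apply, AddChar.one_apply, sub_mul, mul_comm, mul_comm (τ x),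
      ← smul_eq_mul, ← smul_eq_mul, ← map_smul, ← map_smul, AddChar.map_sub_eq_div, h1,
      div_self (ψ.val_isUnit _).ne_zero]
  have hcard : Fintype.card (Dual F V) = Fintype.card (AddChar V ℂ) := by
    rw [AddChar.card_eq, Module.card_eq_pow_finrank (K := F) (V := V),
      Module.card_eq_pow_finrank (K := F) (V := Dual F V), Subspace.dual_finrank_eq]
  obtain ⟨τ, hτ⟩ := ((Fintype.bijective_iff_injective_and_card f).2 ⟨hf, hcard⟩).2 φ
  exact ⟨τ, fun x => (DFunLike.congr_fun hτ x).symm⟩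

variable {V : Type*} [AddCommGroup V] [Module ℂ V]

/-- If the additive group `A` acts on `V` and `a` acts nontrivially, then `V` has a joint
eigenvector on which `a` acts nontrivially. -/
theorem AddChar.exists_eigenvector {A : Type*} [AddCommGroup A] [Finite A]
    (σ : A → V →ₗ[ℂ] V) (h0 : σ 0 = 1) (hadd : ∀ x y, σ (x + y) = σ x * σ y)
    (a : A) (ha : σ a ≠ 1) :
    ∃ (φ : AddChar A ℂ) (v : V), v ≠ 0 ∧ φ a ≠ 1 ∧ ∀ x, σ x v = φ x • v := by
  classical
  have _ := Fintype.ofFinite A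
  have hex : ∃ v, σ a v ≠ v := by
    by_contra! h
    exact ha (LinearMap.ext h)
  obtain ⟨v, hv⟩ := hex
  -- Up to the factor `|A|`, this is the projection of `v` to the `φ`-eigenspace. The projections
  -- sum to `|A| v`, so if `a` fixed all of them it would fix `v`.
  let p : AddChar A ℂ → V := fun φ => ∑ x, φ (-x) • σ x v
  have hp (φ : AddChar A ℂ) (y : A) : σ y (p φ) = φ y • p φ := by
    simp only [p, map_sum, map_smul, Finset.smul_sum]
    refine Fintype.sum_equiv (Equiv.addLeft y) _ _ fun x => ?_
    rw [Equiv.coe_addLeft, hadd, Module.End.mul_apply, smul_smul, ← AddChar.map_add_eq_mul,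
      neg_add, add_neg_cancel_left]
  have hsum : ∑ φ, p φ = (Fintype.card A : ℂ) • v := by
    simp only [p]
    rw [Finset.sum_comm]
    simp_rw [← Finset.sum_smul, AddChar.sum_apply_eq_ite]
    simp [h0]
  by_contra! hcon
  have hfix (φ : AddChar A ℂ) : σ a (p φ) = p φ := by
    by_cases hz : p φ = 0
    · rw [hz, map_zero]
    · by_cases h1 : φ a = 1
      · rw [hp, h1, one_smul]
      · obtain ⟨x, hx⟩ := hcon φ (p φ) hz h1
        exact absurd (hp φ x) hx
  have hfix' : σ a (∑ φ, p φ) = ∑ φ, p φ := by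
    rw [map_sum]
    exact Finset.sum_congr rfl fun φ _ => hfix φ
  rw [hsum, map_smul] at hfix'
  have hc : (Fintype.card A : ℂ) ≠ 0 := by exact_mod_cast Fintype.card_ne_zero
  exact hv (smul_right_injective V hc hfix')

/-- Joint eigenvectors with distinct characters are linearly independent. -/
theorem AddChar.linearIndependent_eigenvectors {A ι : Type*} [AddCommGroup A] [Finite A]
    (σ : A → V →ₗ[ℂ] V) (φ : ι → AddChar A ℂ) (hφ : Function.Injective φ) (w : ι → V)
    (hw : ∀ i, w i ≠ 0) (hσ : ∀ i x, σ x (w i) = φ i x • w i) : LinearIndependent ℂ w := by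
  rw [linearIndependent_iff']
  intro s g hg i hi
  by_contra hgi
  -- Applying a functional with `f (w i) ≠ 0` to the translates of the relation gives a linear
  -- relation between distinct characters, contradicting their independence.
  obtain ⟨f, hf⟩ := Projective.exists_dual_ne_zero ℂ (hw i)
  have hli := (AddChar.linearIndependent A ℂ).comp φ hφ
  rw [linearIndependent_iff'] at hli
  have := hli s (fun j => g j * f (w j)) ?_ i hi
  · exact mul_ne_zero hgi hf this
  · ext x
    have hx := congrArg (fun v => f (σ x v)) hg
    simp only [map_sum, map_smul, hσ, map_zero, smul_eq_mul] at hx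
    simp only [Function.comp_apply, Finset.sum_apply, Pi.smul_apply, smul_eq_mul, Pi.zero_apply]
    rw [← hx]
    exact Finset.sum_congr rfl fun j _ => by ring

/-- A representation of the Heisenberg group of order `q ^ 5` with nontrivial centre has dimension
at least `q ^ 2`. -/
theorem card_sq_le_finrank_of_heisenberg {F : Type*} [Field F] [Fintype F]
    [FiniteDimensional ℂ V] (σ : F × F × F → V →ₗ[ℂ] V) (u : F × F → V →ₗ[ℂ] V)
    (h0 : σ 0 = 1) (hadd : ∀ x y, σ (x + y) = σ x * σ y)
    (hu : ∀ y, Function.Injective (u y))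
    (hσu : ∀ s r c d, σ (s, r, 0) * u (c, d) = u (c, d) * σ (s, r, s * c + r * d))
    (t : F) (ht : σ (0, 0, t) ≠ 1) : Fintype.card F ^ 2 ≤ finrank ℂ V := by
  obtain ⟨φ, v, hv, hφ, hσ⟩ := AddChar.exists_eigenvector σ h0 hadd _ ht
  -- By the commutation relation, `χ y` is the character through which the elements `(s, r, 0)` act
  -- on `u y v`. These `q²` characters are distinct because `φ (0, 0, t) ≠ 1`, and so the vectors `u
  -- y v` are independent.
  let χ : F × F → AddChar (F × F) ℂ := fun y =>
    { toFun := fun x => φ (x.1, x.2, x.1 * y.1 + x.2 * y.2)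
      map_zero_eq_one' := by
        rw [Prod.fst_zero, Prod.snd_zero, zero_mul, zero_mul, add_zero]
        exact φ.map_zero_eq_one
      map_add_eq_mul' := fun x x' => by
        rw [← AddChar.map_add_eq_mul]
        congr 1
        simp only [Prod.fst_add, Prod.snd_add, Prod.mk_add_mk, Prod.mk.injEq, true_and]
        ring }
  have hχ (y x : F × F) : χ y x = φ (x.1, x.2, x.1 * y.1 + x.2 * y.2) := rfl
  have hsplit (s r t : F) : φ (s, r, t) = φ (s, r, 0) * φ (0, 0, t) := by
    rw [← AddChar.map_add_eq_mul]; simp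
  have hunit (s r t : F) : φ (s, r, t) ≠ 0 := (φ.val_isUnit _).ne_zero
  have hχinj : Function.Injective χ := by
    have key (s r c d c' d' : F) (h : χ (c, d) = χ (c', d')) :
        φ (0, 0, (s * c + r * d) - (s * c' + r * d')) = 1 := by
      have h1 := DFunLike.congr_fun h (s, r)
      rw [hχ, hχ, hsplit, hsplit s r (_ + _)] at h1
      have h2 := mul_left_cancel₀ (hunit s r 0) h1
      have e : ((0, 0, (s * c + r * d) - (s * c' + r * d')) : F × F × F)
        = (0, 0, s * c + r * d) - (0, 0, s * c' + r * d') := by simp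
      rw [e, AddChar.map_sub_eq_div]
      exact (div_eq_one_iff_eq (hunit 0 0 _)).2 h2
    rintro ⟨c, d⟩ ⟨c', d'⟩ h
    refine Prod.ext ?_ ?_
    · by_contra hne
      have hne' : c - c' ≠ 0 := sub_ne_zero.2 hne
      apply hφ
      have := key (t / (c - c')) 0 c d c' d' h
      rwa [show t / (c - c') * c + 0 * d - (t / (c - c') * c' + 0 * d') = t by
        field_simp; ring] at this
    · by_contra hne
      have hne' : d - d' ≠ 0 := sub_ne_zero.2 hne
      apply hφ
      have := key 0 (t / (d - d')) c d c' d' h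
      rwa [show 0 * c + t / (d - d') * d - (0 * c' + t / (d - d') * d') = t by
        field_simp; ring] at this
  have hli := AddChar.linearIndependent_eigenvectors (fun x : F × F => σ (x.1, x.2, 0)) χ hχinj
    (fun y => u y v) (fun y => (map_ne_zero_iff _ (hu y)).2 hv) fun y x => by
      rw [← Module.End.mul_apply, hσu, Module.End.mul_apply, hσ, map_smul]
      rfl
  have := hli.fintype_card_le_finrank
  rwa [Fintype.card_prod, ← sq] at this

end AdditiveCharacters

/-! ### Powers of the pattern algebra and commutators in the group -/

section PatternStructure

variable {n : ℕ} {F : Type*} [Field F] {D : ClosedRootSet n}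

/-- The elements of the pattern algebra supported on the positions satisfying `P`. -/
def patternSupported (F : Type*) [Field F] (D : ClosedRootSet n) (P : Fin n → Fin n → Prop) :
    Submodule F (patternAlgebra F D) where
  carrier := {X | ∀ i j, X.1 i j ≠ 0 → P i j}
  zero_mem' := fun i j h => absurd rfl h
  add_mem' := by
    intro X Y hX hY i j h
    by_cases h0 : X.1 i j = 0
    · exact hY i j (by simpa [h0] using h)
    · exact hX i j h0
  smul_mem' := by
    intro c X hX i j h
    exact hX i j (fun h0 => h (by simp [h0]))

/-- The positions which are sums of two roots in `D`. -/
def ClosedRootSet.IsSumTwo (D : ClosedRootSet n) (i j : Fin n) : Prop :=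
  ∃ k, (i, k) ∈ D.carrier ∧ (k, j) ∈ D.carrier

/-- The positions which are sums of three roots in `D`. -/
def ClosedRootSet.IsSumThree (D : ClosedRootSet n) (i j : Fin n) : Prop :=
  ∃ k l, (i, k) ∈ D.carrier ∧ (k, l) ∈ D.carrier ∧ (l, j) ∈ D.carrier

/-- The square of the pattern algebra. -/
def patternSquare (F : Type*) [Field F] (D : ClosedRootSet n) :
    Submodule F (patternAlgebra F D) :=
  patternSupported F D D.IsSumTwo

/-- The cube of the pattern algebra. -/
def patternCube (F : Type*) [Field F] (D : ClosedRootSet n) :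
    Submodule F (patternAlgebra F D) :=
  patternSupported F D D.IsSumThree

theorem patternCube_le_patternSquare : patternCube F D ≤ patternSquare F D := by
  intro X hX i j hij
  obtain ⟨k, l, h1, h2, h3⟩ := hX i j hij
  exact ⟨k, h1, D.closed h2 h3⟩

theorem exists_mul_ne_zero {X Y : patternAlgebra F D} {i j : Fin n} (h : (X * Y).1 i j ≠ 0) :
    ∃ k, X.1 i k ≠ 0 ∧ Y.1 k j ≠ 0 := by
  change (X.1 * Y.1) i j ≠ 0 at h
  rw [Matrix.mul_apply] at h
  obtain ⟨k, -, hk⟩ := Finset.exists_ne_zero_of_sum_ne_zero h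
  exact ⟨k, left_ne_zero_of_mul hk, right_ne_zero_of_mul hk⟩

theorem mul_mem_patternSquare (X Y : patternAlgebra F D) : X * Y ∈ patternSquare F D := by
  intro i j h
  obtain ⟨k, hX, hY⟩ := exists_mul_ne_zero h
  exact ⟨k, X.2 _ _ hX, Y.2 _ _ hY⟩

theorem mul_mem_patternCube_of_left {X : patternAlgebra F D} (hX : X ∈ patternSquare F D)
    (Y : patternAlgebra F D) : X * Y ∈ patternCube F D := by
  intro i j h
  obtain ⟨k, h1, h2⟩ := exists_mul_ne_zero h
  obtain ⟨l, h3, h4⟩ := hX _ _ h1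
  exact ⟨l, k, h3, h4, Y.2 _ _ h2⟩

theorem mul_mem_patternCube_of_right (X : patternAlgebra F D) {Y : patternAlgebra F D}
    (hY : Y ∈ patternSquare F D) : X * Y ∈ patternCube F D := by
  intro i j h
  obtain ⟨k, h1, h2⟩ := exists_mul_ne_zero h
  obtain ⟨l, h3, h4⟩ := hY _ _ h2
  exact ⟨k, l, X.2 _ _ h1, h3, h4⟩

theorem det_one_add_patternAlgebra (X : patternAlgebra F D) :
    (1 + (X : Matrix (Fin n) (Fin n) F)).det = 1 := by
  rw [Matrix.det_of_isUpperTriangular]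
  · refine Finset.prod_eq_one fun i _ => ?_
    have : X.1 i i = 0 := by
      by_contra h
      exact lt_irrefl _ (D.lt_of_mem (X.2 i i h))
    simp [this]
  · intro i j (hij : j < i)
    have : X.1 i j = 0 := by
      by_contra h
      exact lt_asymm hij (D.lt_of_mem (X.2 i j h))
    simp [this, Matrix.one_apply_ne hij.ne']

/-- The bijection `X ↦ 1 + X` from the pattern algebra onto the pattern group. -/
noncomputable def oneAdd : patternAlgebra F D ≃ patternGroup F D where
  toFun X := ⟨Matrix.GeneralLinearGroup.mkOfDetNeZero (1 + X.1)
    (by rw [det_one_add_patternAlgebra]; exact one_ne_zero), by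
      change (1 + X.1) - 1 ∈ patternAlgebra F D
      rw [add_sub_cancel_left]
      exact X.2⟩
  invFun g := ⟨(g.1 : Matrix (Fin n) (Fin n) F) - 1, g.2⟩
  left_inv X := Subtype.ext (add_sub_cancel_left 1 X.1)
  right_inv g := Subtype.ext (Units.ext (add_sub_cancel 1 _))

theorem coe_oneAdd (X : patternAlgebra F D) :
    ((oneAdd X).1 : Matrix (Fin n) (Fin n) F) = 1 + X.1 := rfl

theorem oneAdd_zero : oneAdd (0 : patternAlgebra F D) = 1 :=
  Subtype.ext (Units.ext (add_zero 1))

theorem oneAdd_mul (X Y : patternAlgebra F D) :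
    oneAdd X * oneAdd Y = oneAdd (X + Y + X * Y) := by
  refine Subtype.ext (Units.ext ?_)
  change (1 + X.1) * (1 + Y.1) = 1 + (X.1 + Y.1 + X.1 * Y.1)
  noncomm_ring

theorem exists_inv_oneAdd (X : patternAlgebra F D) :
    ∃ Y, (oneAdd X)⁻¹ = oneAdd Y ∧ X + Y + X * Y = 0 ∧ X + Y + Y * X = 0 := by
  refine ⟨oneAdd.symm (oneAdd X)⁻¹, (oneAdd.apply_symm_apply _).symm, ?_, ?_⟩
  · apply oneAdd.injective
    rw [← oneAdd_mul, oneAdd.apply_symm_apply, mul_inv_cancel, oneAdd_zero]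
  · apply oneAdd.injective
    rw [add_comm X, ← oneAdd_mul, oneAdd.apply_symm_apply, inv_mul_cancel, oneAdd_zero]

/-- With `(1 + V)⁻¹ = 1 + V'`, the quotient `(1 + U)(1 + V)⁻¹` is `1 + (U - V)(1 + V')`. Hence
congruences modulo the square or the cube pass from the algebra to the group. -/
theorem exists_oneAdd_eq_mul (V : patternAlgebra F D) :
    ∃ V', ∀ U, oneAdd U = oneAdd ((U - V) + (U - V) * V') * oneAdd V := by
  obtain ⟨V', hV', h1, -⟩ := exists_inv_oneAdd V
  refine ⟨V', fun U => ?_⟩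
  rw [← mul_inv_eq_iff_eq_mul, hV', oneAdd_mul]
  congr 1
  have : U - V + (U - V) * V' = U + V' + U * V' - (V + V' + V * V') := by rw [sub_mul]; abel
  rw [this, h1, sub_zero]

theorem exists_oneAdd_eq_mul_of_sub_mem_cube {U V : patternAlgebra F D}
    (h : U - V ∈ patternCube F D) :
    ∃ W ∈ patternCube F D, oneAdd U = oneAdd W * oneAdd V := by
  obtain ⟨V', hV'⟩ := exists_oneAdd_eq_mul V
  exact ⟨_, add_mem h (mul_mem_patternCube_of_left (patternCube_le_patternSquare h) _), hV' U⟩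

theorem exists_oneAdd_eq_mul_of_sub_mem_square {U V : patternAlgebra F D}
    (h : U - V ∈ patternSquare F D) :
    ∃ W ∈ patternSquare F D, W - (U - V) ∈ patternCube F D ∧
      oneAdd U = oneAdd W * oneAdd V := by
  obtain ⟨V', hV'⟩ := exists_oneAdd_eq_mul V
  have h3 := mul_mem_patternCube_of_left h V'
  refine ⟨_, add_mem h (patternCube_le_patternSquare h3), ?_, hV' U⟩
  rwa [add_sub_cancel_left]

/-- The commutator of `1 + X` and `1 + Y` is `1 + [X, Y]` modulo the cube. -/
theorem exists_oneAdd_mul_comm (X Y : patternAlgebra F D) :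
    ∃ W ∈ patternSquare F D, W - (X * Y - Y * X) ∈ patternCube F D ∧
      oneAdd X * oneAdd Y = oneAdd W * (oneAdd Y * oneAdd X) := by
  rw [oneAdd_mul, oneAdd_mul]
  have e : (X + Y + X * Y) - (Y + X + Y * X) = X * Y - Y * X := by abel
  have h := exists_oneAdd_eq_mul_of_sub_mem_square
    (U := X + Y + X * Y) (V := Y + X + Y * X)
    (e ▸ sub_mem (mul_mem_patternSquare X Y) (mul_mem_patternSquare Y X))
  rwa [e] at h

/-- The matrix unit `c E_{ij}` at a position of `D`. -/
def patternSingle {i j : Fin n} (h : (i, j) ∈ D.carrier) (c : F) : patternAlgebra F D :=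
  ⟨Matrix.single i j c, fun a b hab => by
    by_cases hh : i = a ∧ j = b
    · obtain ⟨rfl, rfl⟩ := hh
      exact h
    · exact absurd (Matrix.single_apply_of_ne _ _ _ _ _ hh) hab⟩

theorem patternSingle_add {i j : Fin n} (h : (i, j) ∈ D.carrier) (c d : F) :
    patternSingle h (c + d) = patternSingle h c + patternSingle h d :=
  Subtype.ext (Matrix.single_add i j c d)

theorem patternSingle_smul {i j : Fin n} (h : (i, j) ∈ D.carrier) (c d : F) :
    patternSingle h (c * d) = c • patternSingle h d :=
  Subtype.ext (by simp [patternSingle])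

theorem patternSingle_zero {i j : Fin n} (h : (i, j) ∈ D.carrier) :
    patternSingle h (0 : F) = 0 :=
  Subtype.ext (Matrix.single_zero i j)

theorem patternSingle_mul_patternSingle {i j k : Fin n} (h : (i, j) ∈ D.carrier)
    (h' : (j, k) ∈ D.carrier) (c d : F) :
    patternSingle h c * patternSingle h' d = patternSingle (D.closed h h') (c * d) :=
  Subtype.ext (by simp [patternSingle])

theorem patternSingle_mul_patternSingle_of_ne {i j k l : Fin n} (h : (i, j) ∈ D.carrier)
    (h' : (k, l) ∈ D.carrier) (hjk : j ≠ k) (c d : F) :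
    patternSingle h c * patternSingle h' d = 0 :=
  Subtype.ext (by simp [patternSingle, hjk])

/-- A subgroup containing the elementary matrices at all positions satisfying `P` contains `1 + X`
for every `X` supported on such positions. -/
theorem oneAdd_mem_of_patternSingle_mem {P : Fin n → Fin n → Prop}
    (K : Subgroup (patternGroup F D))
    (hK : ∀ i j (h : (i, j) ∈ D.carrier), P i j → ∀ c, oneAdd (patternSingle h c) ∈ K)
    {X : patternAlgebra F D} (hX : X ∈ patternSupported F D P) : oneAdd X ∈ K := by
  classical
  induction hm : (Finset.univ.filter fun p : Fin n × Fin n => X.1 p.1 p.2 ≠ 0).card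
    using Nat.strong_induction_on generalizing X with
  | _ m ih =>
    by_cases h0 : X = 0
    · rw [h0, oneAdd_zero]; exact one_mem K
    have hne : ∃ i j, X.1 i j ≠ 0 := by
      by_contra! h
      exact h0 (Subtype.ext (Matrix.ext h))
    -- In the topmost nonzero row `i`, column `i` of `X` vanishes by triangularity. So `(X - S) S =
    -- 0`, and the factor `1 + S` splits off exactly, leaving a matrix with fewer nonzero entries.
    obtain ⟨i, ⟨j, hij⟩, hmin⟩ :=
      (wellFounded_lt (α := Fin n)).has_min {i | ∃ j, X.1 i j ≠ 0} hne
    have hD := X.2 i j hij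
    let S := patternSingle hD (X.1 i j)
    have hS (a b : Fin n) : S.1 a b = if i = a ∧ j = b then X.1 i j else 0 :=
      Matrix.single_apply _ _ _ _ _
    have hsub (a b : Fin n) : (X - S).1 a b = if i = a ∧ j = b then 0 else X.1 a b := by
      change X.1 a b - S.1 a b = _
      rw [hS]
      split_ifs with hab
      · rw [hab.1, hab.2, sub_self]
      · rw [sub_zero]
    have hmul : (X - S) * S = 0 := by
      refine Subtype.ext (Matrix.ext fun a b => ?_)
      by_contra hab
      obtain ⟨k, h1, h2⟩ := exists_mul_ne_zero hab
      rw [hS] at h2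
      obtain ⟨rfl, -⟩ : i = k ∧ j = b := by
        by_contra hh
        exact h2 (if_neg hh)
      rw [hsub] at h1
      have h3 : X.1 a i ≠ 0 := by
        intro hh
        rw [hh, ite_self] at h1
        exact h1 rfl
      exact hmin a ⟨i, h3⟩ (D.lt_of_mem (X.2 a i h3))
    have hprod : oneAdd X = oneAdd (X - S) * oneAdd S := by
      rw [oneAdd_mul, hmul, add_zero, sub_add_cancel]
    rw [hprod]
    refine mul_mem (ih _ ?_ (X := X - S) ?_ rfl) (hK _ _ _ (hX i j hij) _)
    · rw [← hm]
      refine Finset.card_lt_card (Finset.ssubset_iff_of_subset ?_ |>.2 ⟨(i, j), ?_, ?_⟩)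
      · intro p hp
        rw [Finset.mem_filter] at hp ⊢
        refine ⟨hp.1, fun h => hp.2 ?_⟩
        rw [hsub, h, ite_self]
      · simpa using hij
      · simp [hsub]
    · intro a b hab
      rw [hsub] at hab
      exact hX a b fun h => hab (by rw [h, ite_self])

end PatternStructure

/-! ### Coadjoint orbits and the radical of the bracket form -/

section CoadjointOrbits

variable {n : ℕ} {F : Type*} [Field F] {D : ClosedRootSet n}

instance : FiniteDimensional F (patternAlgebra F D) :=
  inferInstanceAs (FiniteDimensional F (patternAlgebra F D).toSubmodule)

/-- The map `Y ↦ T([·, Y])` from the pattern algebra to its dual. -/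
def bracketForm (T : Dual F (patternAlgebra F D)) :
    patternAlgebra F D →ₗ[F] Dual F (patternAlgebra F D) :=
  LinearMap.mk₂ F (fun Y X => T (X * Y - Y * X))
    (fun Y Y' X => by rw [← map_add]; congr 1; noncomm_ring)
    (fun c Y X => by rw [← map_smul, smul_sub, mul_smul_comm, smul_mul_assoc])
    (fun Y X X' => by rw [← map_add]; congr 1; noncomm_ring)
    (fun c Y X => by rw [← map_smul, smul_sub, mul_smul_comm, smul_mul_assoc])

theorem bracketForm_apply (T : Dual F (patternAlgebra F D)) (X Y : patternAlgebra F D) :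
    bracketForm T Y X = T (X * Y - Y * X) := rfl

/-- The radical of the alternating form `(X, Y) ↦ T([X, Y])`. -/
def bracketRadical (T : Dual F (patternAlgebra F D)) : Submodule F (patternAlgebra F D) :=
  LinearMap.ker (bracketForm T)

theorem mem_bracketRadical {T : Dual F (patternAlgebra F D)} {Y : patternAlgebra F D} :
    Y ∈ bracketRadical T ↔ ∀ X, T (X * Y) = T (Y * X) := by
  rw [bracketRadical, LinearMap.mem_ker, LinearMap.ext_iff]
  simp_rw [bracketForm_apply, map_sub, LinearMap.zero_apply, sub_eq_zero]

theorem patternSquare_le_bracketRadical {T : Dual F (patternAlgebra F D)}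
    (hT : ∀ X ∈ patternCube F D, T X = 0) : patternSquare F D ≤ bracketRadical T := by
  intro Y hY
  rw [mem_bracketRadical]
  intro X
  rw [hT _ (mul_mem_patternCube_of_right X hY), hT _ (mul_mem_patternCube_of_left hY X)]

theorem bracketRadical_congr {T T' : Dual F (patternAlgebra F D)}
    (h : ∀ X ∈ patternSquare F D, T X = T' X) : bracketRadical T = bracketRadical T' := by
  ext Y
  simp_rw [mem_bracketRadical, h _ (mul_mem_patternSquare _ _)]

/-- The form is alternating, so the range kills the radical; rank-nullity makes its dimension that
of the annihilator. -/
theorem mem_range_bracketForm_iff {T S : Dual F (patternAlgebra F D)} :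
    S ∈ LinearMap.range (bracketForm T) ↔ ∀ Y ∈ bracketRadical T, S Y = 0 := by
  have hle : LinearMap.range (bracketForm T) ≤ (bracketRadical T).dualAnnihilator := by
    rintro _ ⟨Y, rfl⟩
    rw [Submodule.mem_dualAnnihilator]
    intro X hX
    rw [bracketForm_apply, map_sub, mem_bracketRadical.1 hX, sub_self]
  have heq : LinearMap.range (bracketForm T) = (bracketRadical T).dualAnnihilator := by
    refine Submodule.eq_of_le_of_finrank_eq hle ?_
    have h1 := LinearMap.finrank_range_add_finrank_ker (bracketForm T)
    have h2 := Subspace.finrank_add_finrank_dualAnnihilator_eq (bracketRadical T)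
    rw [bracketRadical] at h2 ⊢
    omega
  rw [heq, Submodule.mem_dualAnnihilator]

/-- Evaluating at `X (1 + Y)` cancels the inverse in the conjugation by `1 + Y`. Every element has
this form by `exists_eq_add_mul`. -/
theorem coadjointRep_inv_oneAdd_apply (T : Dual F (patternAlgebra F D))
    (X Y : patternAlgebra F D) :
    coadjointRep F D (oneAdd Y)⁻¹ T (X + X * Y) = T (X + Y * X) := by
  rw [coadjointRep_apply, inv_inv]
  congr 1
  refine Subtype.ext ?_
  change (oneAdd Y).1.1 * (X.1 + X.1 * Y.1) * ((oneAdd Y)⁻¹).1.1 = X.1 + Y.1 * X.1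
  have e : (oneAdd Y).1.1 * (X.1 + X.1 * Y.1) = (X.1 + Y.1 * X.1) * (oneAdd Y).1.1 := by
    rw [coe_oneAdd]; noncomm_ring
  rw [e, mul_assoc, ← Units.val_mul, ← Subgroup.coe_mul, mul_inv_cancel]
  exact mul_one _

theorem exists_eq_add_mul (Y : patternAlgebra F D) : ∃ Y', Y + Y' + Y * Y' = 0 ∧
    ∀ Z : patternAlgebra F D, Z = (Z + Z * Y') + (Z + Z * Y') * Y := by
  obtain ⟨Y', -, h1, h2⟩ := exists_inv_oneAdd Y
  refine ⟨Y', h1, fun Z => ?_⟩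
  have e : (Z + Z * Y') + (Z + Z * Y') * Y = Z + Z * (Y + Y' + Y' * Y) := by noncomm_ring
  rw [e, h2, mul_zero, add_zero]

theorem coadjointRep_inv_oneAdd_eq_self_iff (T : Dual F (patternAlgebra F D))
    (Y : patternAlgebra F D) :
    coadjointRep F D (oneAdd Y)⁻¹ T = T ↔ Y ∈ bracketRadical T := by
  rw [mem_bracketRadical]
  constructor
  · intro h X
    have := coadjointRep_inv_oneAdd_apply T X Y
    rw [h, map_add, map_add] at this
    exact add_left_cancel this
  · intro h
    ext Z
    obtain ⟨Y', -, hY'⟩ := exists_eq_add_mul Y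
    conv_lhs => rw [hY' Z, coadjointRep_inv_oneAdd_apply, map_add, ← h, ← map_add, ← hY' Z]

/-- The stabilizer of any `T` is exactly `1 + R`, with `R` the radical; this gives the orbit size
without assuming that `T` vanishes on the cube. -/
theorem coadjointRep_eq_self_iff (T : Dual F (patternAlgebra F D)) (Y : patternAlgebra F D) :
    coadjointRep F D (oneAdd Y) T = T ↔ Y ∈ bracketRadical T := by
  rw [← coadjointRep_inv_oneAdd_eq_self_iff]
  constructor <;> intro h
  · conv_lhs => rw [← h]
    rw [← Module.End.mul_apply, ← map_mul, inv_mul_cancel, map_one, Module.End.one_apply]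
  · conv_lhs => rw [← h]
    rw [← Module.End.mul_apply, ← map_mul, mul_inv_cancel, map_one, Module.End.one_apply]

theorem card_coadjointOrbit_mul_card_bracketRadical [Finite F]
    (T : Dual F (patternAlgebra F D)) :
    (coadjointOrbit T).ncard * Nat.card (bracketRadical T) = Nat.card (patternAlgebra F D) := by
  let _ : MulAction (patternGroup F D) (Dual F (patternAlgebra F D)) :=
    MulAction.compHom _ (coadjointRep F D)
  have e1 := Nat.card_congr (MulAction.orbitProdStabilizerEquivGroup (patternGroup F D) T)
  have e2 : Nat.card (MulAction.stabilizer (patternGroup F D) T) = Nat.card (bracketRadical T) :=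
    Nat.card_congr (oneAdd.subtypeEquiv fun Y => (coadjointRep_eq_self_iff T Y).symm).symm
  rw [Nat.card_prod, e2, ← Nat.card_congr (oneAdd (F := F) (D := D))] at e1
  exact e1

theorem encard_coadjointOrbit_eq_iff [Finite F] (T : Dual F (patternAlgebra F D)) (m : ℕ) :
    (coadjointOrbit T).encard = m ↔
      m * Nat.card (bracketRadical T) = Nat.card (patternAlgebra F D) := by
  have hfin : Finite (patternGroup F D) := Finite.of_equiv _ oneAdd
  have hf : (coadjointOrbit T).Finite := Set.finite_range _
  rw [← card_coadjointOrbit_mul_card_bracketRadical T, ← hf.cast_ncard_eq, Nat.cast_inj]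
  have : 0 < Nat.card (bracketRadical T) := Nat.card_pos
  constructor
  · rintro rfl; rfl
  · intro h; exact (Nat.eq_of_mul_eq_mul_right this h).symm

theorem mem_coadjointOrbit_self (T : Dual F (patternAlgebra F D)) : T ∈ coadjointOrbit T :=
  ⟨1, by simp⟩

theorem coadjointOrbit_eq_iff_mem {T T' : Dual F (patternAlgebra F D)} :
    coadjointOrbit T = coadjointOrbit T' ↔ T' ∈ coadjointOrbit T := by
  let _ : MulAction (patternGroup F D) (Dual F (patternAlgebra F D)) :=
    MulAction.compHom _ (coadjointRep F D)
  constructor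
  · intro h; rw [h]; exact mem_coadjointOrbit_self T'
  · intro h; exact (MulAction.orbit_eq_iff.2 h).symm

/-- Beyond first order, the terms of a conjugation are triple products, which `T` kills. The orbit
is therefore the affine space `T + range (bracketForm T)`, that is, `T` plus the annihilator of its
radical. -/
theorem coadjointOrbit_eq_iff {T T' : Dual F (patternAlgebra F D)}
    (hT : ∀ X ∈ patternCube F D, T X = 0) :
    coadjointOrbit T = coadjointOrbit T' ↔ ∀ Y ∈ bracketRadical T, T Y = T' Y := by
  have key (Y : patternAlgebra F D) :
      coadjointRep F D (oneAdd Y)⁻¹ T = T - bracketForm T Y := by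
    ext Z
    obtain ⟨Y', h, hY'⟩ := exists_eq_add_mul Y
    conv_lhs => rw [hY' Z, coadjointRep_inv_oneAdd_apply]
    have e : Z + Z * Y' + Y * (Z + Z * Y') =
        Z - (Z * Y - Y * Z) + (Z * (Y + Y' + Y * Y') - Z * (Y * Y') + Y * (Z * Y')) := by
      noncomm_ring
    rw [e, h, mul_zero, map_add, map_add, map_sub, map_sub T 0, map_zero,
      hT _ (mul_mem_patternCube_of_right _ (mul_mem_patternSquare _ _)),
      hT _ (mul_mem_patternCube_of_right _ (mul_mem_patternSquare _ _)),
      LinearMap.sub_apply, bracketForm_apply, sub_zero, add_zero, add_zero]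
  have h2 : T' ∈ coadjointOrbit T ↔ T - T' ∈ LinearMap.range (bracketForm T) := by
    constructor
    · rintro ⟨g, rfl⟩
      refine ⟨oneAdd.symm g⁻¹, ?_⟩
      have := key (oneAdd.symm g⁻¹)
      rw [Equiv.apply_symm_apply, inv_inv] at this
      simp only [this]
      abel
    · rintro ⟨Y, hY⟩
      exact ⟨(oneAdd Y)⁻¹, by simp only [key, hY]; abel⟩
  rw [coadjointOrbit_eq_iff_mem, h2, mem_range_bracketForm_iff]
  simp_rw [LinearMap.sub_apply, sub_eq_zero]

theorem patternSupported_ext {P : Fin n → Fin n → Prop} {E : Type*} [AddCommGroup E] [Module F E]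
    (f g : patternAlgebra F D →ₗ[F] E)
    (h : ∀ i j (hij : (i, j) ∈ D.carrier), P i j → f (patternSingle hij 1) =
      g (patternSingle hij 1))
    {X : patternAlgebra F D} (hX : X ∈ patternSupported F D P) : f X = g X := by
  classical
  have e : X = ∑ p : Fin n × Fin n, if hp : X.1 p.1 p.2 ≠ 0 then
      X.1 p.1 p.2 • patternSingle (X.2 _ _ hp) 1 else 0 := by
    refine Subtype.ext ?_
    rw [AddSubmonoidClass.coe_finsetSum]
    conv_lhs => rw [Matrix.matrix_eq_sum_single X.1]
    rw [← Finset.univ_product_univ, Finset.sum_product]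
    refine Finset.sum_congr rfl fun i _ => Finset.sum_congr rfl fun j _ => ?_
    split_ifs with h0
    · simp [patternSingle]
    · rw [not_not] at h0
      simp [h0]
  rw [e, map_sum, map_sum]
  refine Finset.sum_congr rfl fun p _ => ?_
  split_ifs with hp
  · rw [map_smul, map_smul, h _ _ _ (hX _ _ hp)]
  · rw [map_zero, map_zero]

/-- A functional whose coadjoint orbit has `q ^ 2` elements vanishes on the cube. -/
theorem apply_eq_zero_of_encard_coadjointOrbit [Fintype F] {T : Dual F (patternAlgebra F D)}
    (hT : (coadjointOrbit T).encard = (Fintype.card F ^ 2 : ℕ)) :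
    ∀ X ∈ patternCube F D, T X = 0 := by
  intro X hX
  refine patternSupported_ext T 0 ?_ hX
  rintro i l hil ⟨j, k, hij, hjk, hkl⟩
  by_contra hne
  rw [LinearMap.zero_apply] at hne
  have hik := D.closed hij hjk
  have hjl := D.closed hjk hkl
  have dij := (D.lt_of_mem hij).ne
  have djk := (D.lt_of_mem hjk).ne
  have dkl := (D.lt_of_mem hkl).ne
  have dik := (D.lt_of_mem hik).ne
  have djl := (D.lt_of_mem hjl).ne
  have dil := (D.lt_of_mem hil).ne
  -- Pairing with `E_jl`, `E_kl`, `E_ik` recovers the three coordinates up to the factor `±T(E_il)`.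
  -- The range of the form thus has at least `q³` elements, yet its size is that of the orbit, `q²`.
  let v : F × F × F → patternAlgebra F D := fun c =>
    patternSingle hij c.1 + patternSingle hik c.2.1 + patternSingle hkl c.2.2
  have hscale (c : F) : T (patternSingle hil c) = c * T (patternSingle hil 1) := by
    rw [← smul_eq_mul, ← map_smul, ← patternSingle_smul, mul_one]
  have hinj : Function.Injective fun c => bracketForm T (v c) := by
    intro c c' h
    have h1 := DFunLike.congr_fun h (patternSingle hjl 1)
    have h2 := DFunLike.congr_fun h (patternSingle hkl 1)
    have h3 := DFunLike.congr_fun h (patternSingle hik 1)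
    simp only [v, bracketForm_apply] at h1 h2 h3
    simp only [mul_add, add_mul, patternSingle_mul_patternSingle,
      patternSingle_mul_patternSingle_of_ne _ _ dil.symm,
      patternSingle_mul_patternSingle_of_ne _ _ dkl.symm,
      patternSingle_mul_patternSingle_of_ne _ _ djk.symm,
      patternSingle_mul_patternSingle_of_ne _ _ djk,
      patternSingle_mul_patternSingle_of_ne _ _ djl.symm,
      patternSingle_mul_patternSingle_of_ne _ _ dik.symm,
      patternSingle_mul_patternSingle_of_ne _ _ dij.symm,
      map_neg, hscale c.1, hscale c'.1, hscale c.2.1, hscale c'.2.1,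
      hscale c.2.2, hscale c'.2.2, mul_one, one_mul, zero_add, add_zero, zero_sub,
      sub_zero, neg_inj] at h1 h2 h3
    have h1' := mul_right_cancel₀ hne h1
    have h2' := mul_right_cancel₀ hne h2
    have h3' := mul_right_cancel₀ hne h3
    exact Prod.ext h1' (Prod.ext h2' h3')
  have hcard := (encard_coadjointOrbit_eq_iff T _).1 hT
  have hr : Nat.card (LinearMap.range (bracketForm T)) * Nat.card (bracketRadical T) =
      Nat.card (patternAlgebra F D) := by
    rw [Submodule.card_eq_card_quotient_mul_card (bracketRadical T), mul_comm]
    congr 1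
    exact Nat.card_congr (LinearMap.quotKerEquivRange (bracketForm T)).symm.toEquiv
  rw [← hr] at hcard
  have hq := Nat.eq_of_mul_eq_mul_right Nat.card_pos hcard
  have hfin : Finite (LinearMap.range (bracketForm T)) := Finite.of_surjective
    (bracketForm T).rangeRestrict (bracketForm T).surjective_rangeRestrict
  have hle := Nat.card_le_card_of_injective
    (fun c => (⟨bracketForm T (v c), ⟨_, rfl⟩⟩ : LinearMap.range (bracketForm T)))
    fun c c' h => hinj (congrArg Subtype.val h)
  rw [Nat.card_prod, Nat.card_prod, Nat.card_eq_fintype_card, ← hq] at hle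
  have h2 := Fintype.one_lt_card (α := F)
  nlinarith [pow_pos (zero_lt_one.trans h2) 2]

end CoadjointOrbits

/-! ### Irreducible characters lying over a functional on the square -/

section CharactersOverFunctionals

variable {n : ℕ} {F : Type*} [Field F] {D : ClosedRootSet n}

theorem AddChar.IsPrimitive.eq_zero_of_forall {ψ : AddChar F ℂ} (hψ : ψ.IsPrimitive) {a : F}
    (h : ∀ c, ψ (c * a) = 1) : a = 0 := by
  by_contra ha
  refine hψ ha (DFunLike.ext _ _ fun c => ?_)
  rw [AddChar.mulShift_apply, mul_comm, h, AddChar.one_apply]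

/-- Since `W` is closed under scalars, `ψ` is trivial on all multiples of each `S X`, which
primitivity forbids unless `S X = 0`. -/
theorem AddChar.IsPrimitive.eq_zero_on {ψ : AddChar F ℂ} (hψ : ψ.IsPrimitive) {V : Type*}
    [AddCommGroup V] [Module F V] (W : Submodule F V) (S : Dual F V)
    (h : ∀ X ∈ W, ψ (S X) = 1) : ∀ X ∈ W, S X = 0 := fun X hX =>
  hψ.eq_zero_of_forall fun c => by
    rw [← smul_eq_mul, ← map_smul]
    exact h _ (W.smul_mem c hX)

theorem exists_mul_oneAdd_eq {X : patternAlgebra F D} (hX : X ∈ patternSquare F D)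
    (Y : patternAlgebra F D) : ∃ X' ∈ patternSquare F D, X' - X ∈ patternCube F D ∧
      oneAdd X * oneAdd Y = oneAdd Y * oneAdd X' := by
  obtain ⟨Y', -, h, -⟩ := exists_inv_oneAdd Y
  have h3 : Y' * X + X * Y + Y' * X * Y ∈ patternCube F D :=
    add_mem (add_mem (mul_mem_patternCube_of_right _ hX) (mul_mem_patternCube_of_left hX _))
      (mul_mem_patternCube_of_left (mul_mem_patternSquare _ _) _)
  refine ⟨X + (Y' * X + X * Y + Y' * X * Y), add_mem hX (patternCube_le_patternSquare h3), ?_, ?_⟩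
  · rwa [add_sub_cancel_left]
  · rw [oneAdd_mul, oneAdd_mul]
    congr 1
    have e : Y + (X + (Y' * X + X * Y + Y' * X * Y)) +
        Y * (X + (Y' * X + X * Y + Y' * X * Y)) =
        X + Y + X * Y + ((Y + Y' + Y * Y') * X + (Y + Y' + Y * Y') * (X * Y)) := by
      noncomm_ring
    rw [e, h, zero_mul, zero_mul, add_zero, add_zero]

/-- `χ` is an irreducible character of the pattern group whose representation restricts to
the square of the pattern algebra as the scalar `1 + X ↦ ψ (T X)`. -/
def LiesOver (ψ : AddChar F ℂ) (T : Dual F (patternAlgebra F D)) (χ : patternGroup F D → ℂ) :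
    Prop :=
  ∃ (V : Type) (_ : AddCommGroup V) (_ : Module ℂ V) (_ : FiniteDimensional ℂ V)
    (ρ : Representation ℂ (patternGroup F D) V), ρ.IsIrreducible ∧ ρ.character = χ ∧
      ∀ X ∈ patternSquare F D, ρ (oneAdd X) = ψ (T X) • 1

theorem LiesOver.isIrreducibleCharacter {ψ : AddChar F ℂ} {T : Dual F (patternAlgebra F D)}
    {χ : patternGroup F D → ℂ} (h : LiesOver ψ T χ) : IsIrreducibleCharacter χ := by
  obtain ⟨V, _, _, _, ρ, hρ, hχ, -⟩ := h
  exact ⟨V, _, _, ‹_›, ρ, hρ, hχ⟩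

theorem LiesOver.congr {ψ : AddChar F ℂ} {T T' : Dual F (patternAlgebra F D)}
    {χ : patternGroup F D → ℂ} (h : LiesOver ψ T χ)
    (hT : ∀ X ∈ patternSquare F D, T X = T' X) : LiesOver ψ T' χ := by
  obtain ⟨V, _, _, _, ρ, hρ, hχ, hN⟩ := h
  exact ⟨V, _, _, ‹_›, ρ, hρ, hχ, fun X hX => hT X hX ▸ hN X hX⟩

theorem LiesOver.apply_one_ne_zero {ψ : AddChar F ℂ} {T : Dual F (patternAlgebra F D)}
    {χ : patternGroup F D → ℂ} (h : LiesOver ψ T χ) : χ 1 ≠ 0 := by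
  obtain ⟨V, _, _, _, ρ, hρ, rfl, -⟩ := h
  exact ρ.character_one_ne_zero hρ

theorem LiesOver.apply_of_mem_square {ψ : AddChar F ℂ} {T : Dual F (patternAlgebra F D)}
    {χ : patternGroup F D → ℂ} (h : LiesOver ψ T χ) {X : patternAlgebra F D}
    (hX : X ∈ patternSquare F D) (g : patternGroup F D) :
    χ (oneAdd X * g) = ψ (T X) * χ g := by
  obtain ⟨V, _, _, _, ρ, hρ, rfl, hN⟩ := h
  simp only [Representation.character, map_mul, hN X hX, smul_mul_assoc, one_mul, map_smul,
    smul_eq_mul]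

theorem LiesOver.unique {ψ : AddChar F ℂ} (hψ : ψ.IsPrimitive)
    {T T' : Dual F (patternAlgebra F D)} {χ : patternGroup F D → ℂ} (h : LiesOver ψ T χ)
    (h' : LiesOver ψ T' χ) : ∀ X ∈ patternSquare F D, T X = T' X := by
  have := hψ.eq_zero_on (patternSquare F D) (T - T') fun X hX => by
    have e := (h.apply_of_mem_square hX 1).symm.trans (h'.apply_of_mem_square hX 1)
    rw [LinearMap.sub_apply, AddChar.map_sub_eq_div, mul_right_cancel₀ h.apply_one_ne_zero e,
      div_self (ψ.val_isUnit _).ne_zero]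
  exact fun X hX => sub_eq_zero.1 (this X hX)

/-- The commutator of `1 + X` and `1 + Y` is `1 + [X, Y]` modulo the cube, and `T` does not see the
cube. -/
theorem mul_eq_smul_of_forall_patternSquare {ψ : AddChar F ℂ} {T : Dual F (patternAlgebra F D)}
    (hT : ∀ X ∈ patternCube F D, T X = 0) {V : Type*} [AddCommGroup V] [Module ℂ V]
    {ρ : Representation ℂ (patternGroup F D) V}
    (hN : ∀ X ∈ patternSquare F D, ρ (oneAdd X) = ψ (T X) • 1) (X Y : patternAlgebra F D) :
    ρ (oneAdd X) * ρ (oneAdd Y) =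
      ψ (T (X * Y - Y * X)) • (ρ (oneAdd Y) * ρ (oneAdd X)) := by
  obtain ⟨W, hW, hW', e⟩ := exists_oneAdd_mul_comm X Y
  have := hT _ hW'
  rw [map_sub, sub_eq_zero] at this
  rw [← map_mul, e, map_mul, hN W hW, this, smul_mul_assoc, one_mul, map_mul]

/-- Some `Y` has `T([X, Y]) ≠ 0`; after rescaling `Y`, the commutator acts by a scalar other than 1,
which forces the trace to vanish. -/
theorem LiesOver.apply_eq_zero {ψ : AddChar F ℂ} (hψ : ψ.IsPrimitive)
    {T : Dual F (patternAlgebra F D)} (hT : ∀ X ∈ patternCube F D, T X = 0)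
    {χ : patternGroup F D → ℂ} (h : LiesOver ψ T χ) {X : patternAlgebra F D}
    (hX : X ∉ bracketRadical T) : χ (oneAdd X) = 0 := by
  obtain ⟨V, _, _, _, ρ, hρ, rfl, hN⟩ := h
  rw [mem_bracketRadical] at hX
  push Not at hX
  obtain ⟨Y, hY⟩ := hX
  have hc : ∃ c, ψ (c * T (X * Y - Y * X)) ≠ 1 := by
    by_contra! hc
    have := hψ.eq_zero_of_forall hc
    rw [map_sub, sub_eq_zero] at this
    exact hY this.symm
  obtain ⟨c, hc⟩ := hc
  refine ρ.character_eq_zero_of_mul_eq_smul (oneAdd X) (oneAdd (c • Y)) _ hc ?_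
  rw [mul_eq_smul_of_forall_patternSquare hT hN, mul_smul_comm, smul_mul_assoc, ← smul_sub,
    map_smul, smul_eq_mul]

/-- For `X` in the radical, all commutators with `1 + X` act trivially, so `1 + X` acts as a scalar
by Schur's lemma. -/
theorem LiesOver.apply_mul {ψ : AddChar F ℂ} {T : Dual F (patternAlgebra F D)}
    (hT : ∀ X ∈ patternCube F D, T X = 0) {χ : patternGroup F D → ℂ} (h : LiesOver ψ T χ)
    {X : patternAlgebra F D} (hX : X ∈ bracketRadical T) (g : patternGroup F D) :
    χ (oneAdd X * g) = χ (oneAdd X) / χ 1 * χ g := by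
  have h1 := h.apply_one_ne_zero
  obtain ⟨V, _, _, _, ρ, hρ, rfl, hN⟩ := h
  obtain ⟨c, hc⟩ := ρ.exists_eq_smul_one_of_commute hρ (oneAdd X) fun g => by
    obtain ⟨Y, rfl⟩ := oneAdd.surjective g
    rw [mul_eq_smul_of_forall_patternSquare hT hN, map_sub, mem_bracketRadical.1 hX, sub_self,
      AddChar.map_zero_eq_one, one_smul]
  have key (g : patternGroup F D) : ρ.character (oneAdd X * g) = c * ρ.character g := by
    simp only [Representation.character, map_mul, hc, smul_mul_assoc, one_mul, map_smul,
      smul_eq_mul]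
  have := key 1
  rw [mul_one] at this
  rw [key, this, mul_div_cancel_right₀ _ h1]

theorem LiesOver.apply_ne_zero {ψ : AddChar F ℂ} {T : Dual F (patternAlgebra F D)}
    (hT : ∀ X ∈ patternCube F D, T X = 0) {χ : patternGroup F D → ℂ} (h : LiesOver ψ T χ)
    {X : patternAlgebra F D} (hX : X ∈ bracketRadical T) : χ (oneAdd X) ≠ 0 := fun h0 => by
  have := h.apply_mul hT hX (oneAdd X)⁻¹
  rw [mul_inv_cancel, h0, zero_div, zero_mul] at this
  exact h.apply_one_ne_zero this

/-- In `∑ χ(g) χ(g⁻¹) = |G|`, each element of `1 + R`, with `R` the radical, contributes `χ(1)²` and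
all others contribute 0. This is the orbit-size equation with `m²` in place of `m`. -/
theorem LiesOver.apply_one_eq_iff [Finite F] {ψ : AddChar F ℂ} (hψ : ψ.IsPrimitive)
    {T : Dual F (patternAlgebra F D)} (hT : ∀ X ∈ patternCube F D, T X = 0)
    {χ : patternGroup F D → ℂ} (h : LiesOver ψ T χ) (m : ℕ) :
    χ 1 = m ↔ m ^ 2 * Nat.card (bracketRadical T) = Nat.card (patternAlgebra F D) := by
  classical
  have hfin : Finite (patternGroup F D) := Finite.of_equiv _ oneAdd
  have _ := Fintype.ofFinite (patternGroup F D)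
  have _ := Fintype.ofFinite (patternAlgebra F D)
  have hsum : ∑ g, χ g * χ g⁻¹ = Nat.card (patternGroup F D) := by
    obtain ⟨V, _, _, _, ρ, hρ, rfl, -⟩ := h
    exact ρ.sum_character_mul_character_inv hρ
  have hterm (X : patternAlgebra F D) : χ (oneAdd X) * χ (oneAdd X)⁻¹ =
      if X ∈ bracketRadical T then χ 1 ^ 2 else 0 := by
    split_ifs with hX
    · have := h.apply_mul hT hX (oneAdd X)⁻¹
      rw [mul_inv_cancel, div_mul_eq_mul_div, eq_div_iff h.apply_one_ne_zero] at this
      rw [← this, sq]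
    · rw [h.apply_eq_zero hψ hT hX, zero_mul]
  rw [← (oneAdd (F := F) (D := D)).sum_comp] at hsum
  simp only [hterm] at hsum
  rw [← Finset.sum_filter, Finset.sum_const, nsmul_eq_mul, ← Nat.card_congr oneAdd,
    ← Fintype.card_subtype, ← Nat.card_eq_fintype_card] at hsum
  obtain ⟨d, hd⟩ : ∃ d : ℕ, χ 1 = d := by
    obtain ⟨V, _, _, _, ρ, hρ, rfl, -⟩ := h
    exact ⟨_, ρ.char_one⟩
  rw [hd] at hsum ⊢
  have hd2 : d ^ 2 * Nat.card (bracketRadical T) = Nat.card (patternAlgebra F D) := by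
    rw [mul_comm]
    exact_mod_cast hsum
  rw [Nat.cast_inj, ← hd2]
  constructor
  · rintro rfl; rfl
  · intro hm
    exact (Nat.pow_left_injective two_ne_zero (Nat.eq_of_mul_eq_mul_right Nat.card_pos hm)).symm

/-- The linear character `1 + X ↦ ψ (S X)` for a functional `S` vanishing on the square. -/
noncomputable def patternLinearCharacter (ψ : AddChar F ℂ) (S : Dual F (patternAlgebra F D))
    (hS : ∀ X ∈ patternSquare F D, S X = 0) : patternGroup F D →* ℂ where
  toFun g := ψ (S (oneAdd.symm g))
  map_one' := by
    rw [← oneAdd_zero, Equiv.symm_apply_apply, map_zero, AddChar.map_zero_eq_one]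
  map_mul' g h := by
    obtain ⟨X, rfl⟩ := oneAdd.surjective g
    obtain ⟨Y, rfl⟩ := oneAdd.surjective h
    rw [oneAdd_mul, Equiv.symm_apply_apply, Equiv.symm_apply_apply, Equiv.symm_apply_apply,
      map_add S, map_add S, hS _ (mul_mem_patternSquare X Y), add_zero, AddChar.map_add_eq_mul]

theorem LiesOver.twist {ψ : AddChar F ℂ} {T : Dual F (patternAlgebra F D)}
    {χ : patternGroup F D → ℂ} (h : LiesOver ψ T χ) {S : Dual F (patternAlgebra F D)}
    (hS : ∀ X ∈ patternSquare F D, S X = 0) :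
    LiesOver ψ T fun g => ψ (S (oneAdd.symm g)) * χ g := by
  obtain ⟨V, _, _, _, ρ, hρ, rfl, hN⟩ := h
  refine ⟨V, _, _, ‹_›, ρ.twist (patternLinearCharacter ψ S hS), ρ.twist_isIrreducible _ hρ,
    funext fun g => ρ.character_twist _ g, fun X hX => ?_⟩
  have : patternLinearCharacter ψ S hS (oneAdd X) = 1 := by
    change ψ (S (oneAdd.symm (oneAdd X))) = 1
    rw [Equiv.symm_apply_apply, hS X hX, AddChar.map_zero_eq_one]
  rw [Representation.twist_apply, this, one_smul, hN X hX]

theorem LiesOver.twist_eq_twist_iff {ψ : AddChar F ℂ} (hψ : ψ.IsPrimitive)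
    {T : Dual F (patternAlgebra F D)} (hT : ∀ X ∈ patternCube F D, T X = 0)
    {χ : patternGroup F D → ℂ} (h : LiesOver ψ T χ) (S S' : Dual F (patternAlgebra F D)) :
    ((fun g => ψ (S (oneAdd.symm g)) * χ g) = fun g => ψ (S' (oneAdd.symm g)) * χ g) ↔
      ∀ X ∈ bracketRadical T, S X = S' X := by
  constructor
  · intro e
    have := hψ.eq_zero_on (bracketRadical T) (S - S') fun X hX => by
      have := congrFun e (oneAdd X)
      simp only [Equiv.symm_apply_apply] at this
      rw [LinearMap.sub_apply, AddChar.map_sub_eq_div,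
        mul_right_cancel₀ (h.apply_ne_zero hT hX) this, div_self (ψ.val_isUnit _).ne_zero]
    exact fun X hX => sub_eq_zero.1 (this X hX)
  · intro e
    funext g
    obtain ⟨X, rfl⟩ := oneAdd.surjective g
    rw [Equiv.symm_apply_apply]
    by_cases hX : X ∈ bracketRadical T
    · rw [e X hX]
    · rw [h.apply_eq_zero hψ hT hX, mul_zero, mul_zero]

/-- Both characters vanish off `1 + R`, with `R` the radical, and have the same degree. Their ratio
on `1 + R` is an additive character of `R`, hence of the form `ψ ∘ S₀`, and any linear extension of
`S₀` gives the twist. -/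
theorem LiesOver.exists_twist_eq [Finite F] {ψ : AddChar F ℂ} (hψ : ψ.IsPrimitive)
    {T : Dual F (patternAlgebra F D)} (hT : ∀ X ∈ patternCube F D, T X = 0)
    {χ χ' : patternGroup F D → ℂ} (h : LiesOver ψ T χ) (h' : LiesOver ψ T χ') :
    ∃ S : Dual F (patternAlgebra F D), (∀ X ∈ patternSquare F D, S X = 0) ∧
      χ' = fun g => ψ (S (oneAdd.symm g)) * χ g := by
  have h1 := h.apply_one_ne_zero
  have h1' := h'.apply_one_ne_zero
  have hle := patternSquare_le_bracketRadical hT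
  have hdeg : χ' 1 = χ 1 := by
    obtain ⟨d, hd⟩ : ∃ d : ℕ, χ 1 = d := by
      obtain ⟨V, _, _, _, ρ, hρ, rfl, -⟩ := h
      exact ⟨_, ρ.char_one⟩
    rw [hd, h'.apply_one_eq_iff hψ hT, ← h.apply_one_eq_iff hψ hT, hd]
  have hadd {η : patternGroup F D → ℂ} (hη : LiesOver ψ T η) {X Y W : patternAlgebra F D}
      (hX : X ∈ bracketRadical T) (hW : W ∈ patternSquare F D)
      (e : oneAdd (X + Y + X * Y) = oneAdd W * oneAdd (X + Y)) :
      ψ (T W) * η (oneAdd (X + Y)) = η (oneAdd X) / η 1 * η (oneAdd Y) := by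
    rw [← hη.apply_of_mem_square hW, ← e, ← oneAdd_mul, hη.apply_mul hT hX]
  -- Each normalized character is additive on the radical only up to the factor `ψ (T W)` from
  -- `hadd`. The factor is the same for `χ` and `χ'` and cancels in the ratio.
  let κ : AddChar (bracketRadical T) ℂ :=
    { toFun := fun X => χ' (oneAdd X) / χ (oneAdd X)
      map_zero_eq_one' := by
        rw [ZeroMemClass.coe_zero, oneAdd_zero, hdeg, div_self h1]
      map_add_eq_mul' := fun X Y => by
        obtain ⟨W, hW, -, e⟩ := exists_oneAdd_eq_mul_of_sub_mem_square
          (U := X.1 + Y.1 + X.1 * Y.1) (V := X.1 + Y.1)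
          (by rw [add_sub_cancel_left]; exact mul_mem_patternSquare _ _)
        have e1 := hadd h X.2 hW e
        have e2 := hadd h' X.2 hW e
        have hX := h.apply_ne_zero hT X.2
        have hY := h.apply_ne_zero hT Y.2
        have hXY := h.apply_ne_zero hT (X + Y).2
        have hψW := (ψ.val_isUnit (T W)).ne_zero
        rw [Submodule.coe_add] at hXY ⊢
        rw [← mul_div_mul_left _ _ hψW, e1, e2, hdeg]
        field_simp }
  have hκ (X : bracketRadical T) : κ X = χ' (oneAdd X) / χ (oneAdd X) := rfl
  obtain ⟨S₀, hS₀⟩ := AddChar.exists_linear_of_isPrimitive hψ κ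
  obtain ⟨S, hS⟩ := LinearMap.exists_extend S₀
  have hSκ (X : patternAlgebra F D) (hX : X ∈ bracketRadical T) :
      ψ (S X) = χ' (oneAdd X) / χ (oneAdd X) := by
    rw [← hκ ⟨X, hX⟩, hS₀, ← hS]
    rfl
  refine ⟨S, hψ.eq_zero_on _ S fun X hX => ?_, funext fun g => ?_⟩
  · have e := h.apply_of_mem_square hX 1
    have e' := h'.apply_of_mem_square hX 1
    rw [mul_one] at e e'
    have : ψ (T X) * χ 1 ≠ 0 := e ▸ h.apply_ne_zero hT (hle hX)
    rw [hSκ X (hle hX), e, e', hdeg, div_self this]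
  · obtain ⟨X, rfl⟩ := oneAdd.surjective g
    rw [Equiv.symm_apply_apply]
    by_cases hX : X ∈ bracketRadical T
    · rw [hSκ X hX, div_mul_cancel₀ _ (h.apply_ne_zero hT hX)]
    · rw [h.apply_eq_zero hψ hT hX, h'.apply_eq_zero hψ hT hX, mul_zero]

/-- The right regular representation of a finite group, on functions on `Fin (Nat.card G)`. -/
noncomputable def finRegularRep (G : Type*) [Group G] [Finite G] :
    Representation ℂ G (Fin (Nat.card G) → ℂ) where
  toFun g := LinearMap.funLeft ℂ ℂ fun a =>
    Finite.equivFin G ((Finite.equivFin G).symm a * g)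
  map_one' := by ext; simp [LinearMap.funLeft]
  map_mul' g h := by ext; simp [LinearMap.funLeft, mul_assoc]

theorem finRegularRep_apply {G : Type*} [Group G] [Finite G] (g : G)
    (f : Fin (Nat.card G) → ℂ) (a : Fin (Nat.card G)) :
    finRegularRep G g f a = f (Finite.equivFin G ((Finite.equivFin G).symm a * g)) := rfl

/-- The functions on which `1 + 𝔞²` acts through `ψ ∘ T` form a subrepresentation of the regular
representation, as conjugation changes elements of `𝔞²` only modulo the cube. It is nonzero, so it
contains an irreducible one. -/
theorem exists_liesOver [Finite F] (ψ : AddChar F ℂ) {T : Dual F (patternAlgebra F D)}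
    (hT : ∀ X ∈ patternCube F D, T X = 0) : ∃ χ, LiesOver ψ T χ := by
  classical
  have hfin : Finite (patternGroup F D) := Finite.of_equiv _ oneAdd
  -- Functions on a `Fin` type keep the space in `Type`, as `LiesOver` requires.
  let ρ := finRegularRep (patternGroup F D)
  let W : Subrepresentation ρ :=
    { toSubmodule :=
        { carrier := {f | ∀ X ∈ patternSquare F D, ρ (oneAdd X) f = ψ (T X) • f}
          zero_mem' := fun X _ => by rw [map_zero, smul_zero]
          add_mem' := fun {f f'} hf hf' X hX => by
            rw [map_add, hf X hX, hf' X hX, smul_add]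
          smul_mem' := fun c f hf X hX => by
            rw [map_smul, hf X hX, smul_comm] }
      apply_mem_toSubmodule := fun g f hf X hX => by
        obtain ⟨Y, rfl⟩ := oneAdd.surjective g
        obtain ⟨X', hX', h3, e⟩ := exists_mul_oneAdd_eq hX Y
        have h4 := hT _ h3
        rw [map_sub, sub_eq_zero] at h4
        rw [← Module.End.mul_apply, ← map_mul, e, map_mul, Module.End.mul_apply, hf X' hX',
          map_smul, h4] }
  -- The function `1 + X ↦ ψ (T X)` on `1 + 𝔞²`, extended by zero.
  let f : Fin (Nat.card (patternGroup F D)) → ℂ := fun a =>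
    if oneAdd.symm ((Finite.equivFin _).symm a) ∈ patternSquare F D then
      ψ (T (oneAdd.symm ((Finite.equivFin _).symm a))) else 0
  have hf : f ∈ W.toSubmodule := by
    intro X hX
    funext a
    obtain ⟨g, rfl⟩ := (Finite.equivFin _).surjective a
    obtain ⟨Y, rfl⟩ := oneAdd.surjective g
    rw [Pi.smul_apply, finRegularRep_apply]
    simp only [f, Equiv.symm_apply_apply, oneAdd_mul]
    have hiff : Y + X + Y * X ∈ patternSquare F D ↔ Y ∈ patternSquare F D := by
      rw [add_assoc]
      exact Submodule.add_mem_iff_left _ (add_mem hX (mul_mem_patternSquare _ _))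
    rw [hiff]
    split_ifs with hY
    · rw [map_add T, map_add T, hT _ (mul_mem_patternCube_of_right _ hX), add_zero,
        AddChar.map_add_eq_mul, mul_comm, smul_eq_mul]
    · rw [smul_zero]
  have hf0 : f ≠ 0 := fun h => by
    have := congrFun h (Finite.equivFin _ 1)
    simp only [f, Equiv.symm_apply_apply, Pi.zero_apply] at this
    rw [← oneAdd_zero, Equiv.symm_apply_apply, if_pos (zero_mem _), map_zero,
      AddChar.map_zero_eq_one] at this
    exact one_ne_zero this
  obtain ⟨U, hUW, hU⟩ := W.exists_le_isIrreducible fun h => by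
    rw [h] at hf
    exact hf0 ((Submodule.mem_bot ℂ).1 hf)
  exact ⟨_, U.toSubmodule, _, _, inferInstance, U.toRepresentation, hU, rfl, fun X hX =>
    LinearMap.ext fun v => Subtype.ext (hUW v.2 X hX)⟩

/-- A representation of degree less than `q ^ 2` is trivial on the elementary matrices at sums of
three roots. -/
theorem map_oneAdd_eq_one_of_finrank_lt [Fintype F] {V : Type*} [AddCommGroup V] [Module ℂ V]
    [FiniteDimensional ℂ V] (ρ : Representation ℂ (patternGroup F D) V)
    (hV : finrank ℂ V < Fintype.card F ^ 2) {X : patternAlgebra F D}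
    (hX : X ∈ patternCube F D) : ρ (oneAdd X) = 1 := by
  have hmem : oneAdd X ∈ MonoidHom.ker ρ := by
    refine oneAdd_mem_of_patternSingle_mem _ ?_ hX
    rintro i l hil ⟨j, k, hij, hjk, hkl⟩ c
    rw [MonoidHom.mem_ker]
    by_contra hne
    have hik := D.closed hij hjk
    have hjl := D.closed hjk hkl
    have dij := (D.lt_of_mem hij).ne
    have djk := (D.lt_of_mem hjk).ne
    have dik := (D.lt_of_mem hik).ne
    have dil := (D.lt_of_mem hil).ne
    -- `E_ij`, `E_ik`, `E_il` span the abelian part; `E_jl` and `E_kl` pair with the first two into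
    -- the centre `E_il`.
    let v : F × F × F → patternAlgebra F D := fun c =>
      patternSingle hij c.1 + patternSingle hik c.2.1 + patternSingle hil c.2.2
    let w : F × F → patternAlgebra F D := fun c =>
      patternSingle hjl c.1 + patternSingle hkl c.2
    refine hV.not_ge (card_sq_le_finrank_of_heisenberg (fun c => ρ (oneAdd (v c)))
      (fun c => ρ (oneAdd (w c))) ?_ ?_ ?_ ?_ c ?_)
    · simp only [v, Prod.fst_zero, Prod.snd_zero, patternSingle_zero, add_zero, oneAdd_zero,
        map_one]
    · intro x y
      have h0 : v x * v y = 0 := by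
        simp only [v, mul_add, add_mul, patternSingle_mul_patternSingle_of_ne _ _ dij.symm,
          patternSingle_mul_patternSingle_of_ne _ _ dik.symm,
          patternSingle_mul_patternSingle_of_ne _ _ dil.symm, add_zero]
      rw [← map_mul, oneAdd_mul, h0, add_zero]
      congr 2
      simp only [v, Prod.fst_add, Prod.snd_add, patternSingle_add]
      abel
    · intro y
      refine Function.LeftInverse.injective (g := ρ (oneAdd (w y))⁻¹) fun x => ?_
      rw [← Module.End.mul_apply, ← map_mul, inv_mul_cancel, map_one, Module.End.one_apply]
    · intro s r c d
      rw [← map_mul ρ, ← map_mul ρ, oneAdd_mul, oneAdd_mul]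
      congr 2
      simp only [v, w, mul_add, add_mul, patternSingle_mul_patternSingle,
        patternSingle_mul_patternSingle_of_ne _ _ dil.symm,
        patternSingle_mul_patternSingle_of_ne _ _ djk,
        patternSingle_mul_patternSingle_of_ne _ _ djk.symm,
        patternSingle_zero, patternSingle_add, add_zero, zero_add]
      abel
    · simpa only [v, patternSingle_zero, zero_add] using hne
  exact hmem

/-- Degree `q < q²` forces triviality on the cube. Then `1 + 𝔞²` acts centrally, hence by scalars,
and these are additive in `X` because products within `𝔞²` lie in the cube. -/
theorem exists_liesOver_of_apply_one [Fintype F] {ψ : AddChar F ℂ} (hψ : ψ.IsPrimitive)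
    {χ : patternGroup F D → ℂ} (h : IsIrreducibleCharacter χ)
    (hχ : χ 1 = (Fintype.card F : ℂ)) :
    ∃ T : Dual F (patternAlgebra F D), (∀ X ∈ patternCube F D, T X = 0) ∧ LiesOver ψ T χ := by
  obtain ⟨V, _, _, _, ρ, hρ, rfl⟩ := h
  have hV : finrank ℂ V < Fintype.card F ^ 2 := by
    rw [ρ.char_one, Nat.cast_inj] at hχ
    rw [hχ]
    exact lt_self_pow₀ Fintype.one_lt_card one_lt_two
  have h3 (X : patternAlgebra F D) (hX : X ∈ patternCube F D) : ρ (oneAdd X) = 1 :=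
    map_oneAdd_eq_one_of_finrank_lt ρ hV hX
  have hscalar (X : patternAlgebra F D) (hX : X ∈ patternSquare F D) :
      ∃ c : ℂ, ρ (oneAdd X) = c • 1 := by
    refine ρ.exists_eq_smul_one_of_commute hρ _ fun g => ?_
    obtain ⟨Y, rfl⟩ := oneAdd.surjective g
    obtain ⟨W, -, hW, e⟩ := exists_oneAdd_mul_comm X Y
    have hW3 : W ∈ patternCube F D := (Submodule.sub_mem_iff_left _ (sub_mem
      (mul_mem_patternCube_of_left hX Y) (mul_mem_patternCube_of_right Y hX))).1 hW
    rw [← map_mul, e, map_mul, h3 W hW3, one_mul, map_mul]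
  have hχ1 := ρ.character_one_ne_zero hρ
  have hρχ (X : patternAlgebra F D) (hX : X ∈ patternSquare F D) :
      ρ (oneAdd X) = (ρ.character (oneAdd X) / ρ.character 1) • 1 := by
    obtain ⟨c, hc⟩ := hscalar X hX
    have e : ρ.character (oneAdd X) = c * ρ.character 1 := by
      simp only [Representation.character, hc, map_one ρ, map_smul, smul_eq_mul]
    rw [e, mul_div_cancel_right₀ _ hχ1, hc]
  let φ : AddChar (patternSquare F D) ℂ :=
    { toFun := fun X => ρ.character (oneAdd X) / ρ.character 1
      map_zero_eq_one' := by rw [ZeroMemClass.coe_zero, oneAdd_zero, div_self hχ1]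
      map_add_eq_mul' := fun X Y => by
        obtain ⟨W, hW, e⟩ := exists_oneAdd_eq_mul_of_sub_mem_cube
          (U := X.1 + Y.1 + X.1 * Y.1) (V := X.1 + Y.1)
          (by rw [add_sub_cancel_left]; exact mul_mem_patternCube_of_right _ Y.2)
        rw [Submodule.coe_add]
        have e1 : ρ (oneAdd (X.1 + Y.1)) = ρ (oneAdd X.1) * ρ (oneAdd Y.1) := by
          rw [← map_mul, oneAdd_mul, e, map_mul, h3 W hW, one_mul]
        have e2 : ρ.character (oneAdd (X.1 + Y.1)) =
            ρ.character (oneAdd X.1) / ρ.character 1 * ρ.character (oneAdd Y.1) := by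
          rw [Representation.character, e1, hρχ X.1 X.2, smul_mul_assoc, one_mul, map_smul,
            smul_eq_mul]
          rfl
        rw [e2, mul_div_assoc] }
  have hφ (X : patternSquare F D) : φ X = ρ.character (oneAdd X) / ρ.character 1 := rfl
  obtain ⟨T₀, hT₀⟩ := AddChar.exists_linear_of_isPrimitive hψ φ
  obtain ⟨T, hT⟩ := LinearMap.exists_extend T₀
  have hTφ (X : patternAlgebra F D) (hX : X ∈ patternSquare F D) :
      ψ (T X) = ρ.character (oneAdd X) / ρ.character 1 := by
    rw [← hφ ⟨X, hX⟩, hT₀, ← hT]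
    rfl
  refine ⟨T, hψ.eq_zero_on _ T fun X hX => ?_, V, _, _, ‹_›, ρ, hρ, rfl, fun X hX => ?_⟩
  · rw [hTφ X (patternCube_le_patternSquare hX), Representation.character, h3 X hX, ← map_one ρ]
    exact div_self hχ1
  · rw [hTφ X hX, ← hρχ X hX]

end CharactersOverFunctionals

/-! ### Matching characters with orbits -/

/-- Two functions with the same fibres on a set have images of the same cardinality. -/
theorem Set.encard_image_eq_encard_image_of_iff {α β γ : Type*} (s : Set α) (f : α → β)
    (g : α → γ) (h : ∀ x ∈ s, ∀ y ∈ s, f x = f y ↔ g x = g y) :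
    (f '' s).encard = (g '' s).encard := by
  cases isEmpty_or_nonempty α
  · simp [Set.eq_empty_of_isEmpty s]
  choose! i hi using fun (b : β) (hb : b ∈ f '' s) => hb
  have himg : g '' s = (g ∘ i) '' (f '' s) := by
    rw [← Set.image_comp]
    refine Set.image_congr fun x hx => ?_
    have := hi (f x) ⟨x, hx, rfl⟩
    exact (h _ hx _ this.1).1 this.2.symm
  rw [himg]
  refine (Set.InjOn.encard_image ?_).symm
  rintro b hb b' hb' e
  rw [← (hi b hb).2, ← (hi b' hb').2]
  exact (h _ (hi b hb).1 _ (hi b' hb').1).2 e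

theorem mainTheorem3 {F : Type*} [Field F] [Fintype F] (n : ℕ) (D : ClosedRootSet n) :
    {χ : patternGroup F D → ℂ |
        IsIrreducibleCharacter χ ∧ χ 1 = (Fintype.card F : ℂ)}.encard =
      {O : Set (Module.Dual F (patternAlgebra F D)) |
        (∃ T, O = coadjointOrbit T) ∧ O.encard = (Fintype.card F ^ 2 : ℕ)}.encard := by
  let ψ := AddChar.FiniteField.primitiveChar_to_Complex F
  have hψ : ψ.IsPrimitive := AddChar.FiniteField.primitiveChar_to_Complex_isPrimitive F
  obtain ⟨π, hπ⟩ := LinearMap.exists_extend (K := F) (V' := patternSquare F D)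
    (p := patternSquare F D) LinearMap.id
  -- A linear projection onto the square: `T ∘ₗ p` depends only on `T` there, and `T - T ∘ₗ p`
  -- vanishes there.
  let p : patternAlgebra F D →ₗ[F] patternAlgebra F D := (patternSquare F D).subtype ∘ₗ π
  have hp_mem (X) : p X ∈ patternSquare F D := (π X).2
  have hp (X) (hX : X ∈ patternSquare F D) : p X = X :=
    congrArg Subtype.val (LinearMap.congr_fun hπ ⟨X, hX⟩)
  have hpp (T : Dual F (patternAlgebra F D)) : ∀ X ∈ patternSquare F D, (T ∘ₗ p) X = T X :=
    fun X hX => congrArg T (hp X hX)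
  have hS (T : Dual F (patternAlgebra F D)) : ∀ X ∈ patternSquare F D, (T - T ∘ₗ p) X = 0 :=
    fun X hX => sub_eq_zero.2 (hpp T X hX).symm
  have hcube (T : Dual F (patternAlgebra F D)) (hT : ∀ X ∈ patternCube F D, T X = 0) :
      ∀ X ∈ patternCube F D, (T ∘ₗ p) X = 0 := fun X hX => by
    rw [hpp T X (patternCube_le_patternSquare hX), hT X hX]
  have hrad (T : Dual F (patternAlgebra F D)) : bracketRadical (T ∘ₗ p) = bracketRadical T :=
    bracketRadical_congr (hpp T)
  choose! base hbase using fun (T : Dual F (patternAlgebra F D))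
    (hT : ∀ X ∈ patternCube F D, T X = 0) => exists_liesOver ψ hT
  let s : Set (Dual F (patternAlgebra F D)) :=
    {T | (coadjointOrbit T).encard = (Fintype.card F ^ 2 : ℕ)}
  -- The base character is indexed by `T ∘ₗ p`, so functionals agreeing on the square share it; the
  -- remainder of `T` supplies the twist. On `s` this map will have the same fibres as
  -- `coadjointOrbit`.
  let g : Dual F (patternAlgebra F D) → patternGroup F D → ℂ := fun T x =>
    ψ ((T - T ∘ₗ p) (oneAdd.symm x)) * base (T ∘ₗ p) x
  have hs {T} (hT : T ∈ s) : ∀ X ∈ patternCube F D, T X = 0 :=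
    apply_eq_zero_of_encard_coadjointOrbit hT
  have hg {T : Dual F (patternAlgebra F D)} (hT : ∀ X ∈ patternCube F D, T X = 0) :
      LiesOver ψ T (g T) :=
    ((hbase _ (hcube T hT)).twist (hS T)).congr (hpp T)
  have hdeg {T : Dual F (patternAlgebra F D)} (hT : ∀ X ∈ patternCube F D, T X = 0)
      {χ : patternGroup F D → ℂ} (h : LiesOver ψ T χ) :
      χ 1 = (Fintype.card F : ℂ) ↔ T ∈ s :=
    (h.apply_one_eq_iff hψ hT _).trans (encard_coadjointOrbit_eq_iff T _).symm
  have hchar : {χ : patternGroup F D → ℂ |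
      IsIrreducibleCharacter χ ∧ χ 1 = (Fintype.card F : ℂ)} = g '' s := by
    ext χ
    constructor
    · rintro ⟨hχ, h1⟩
      obtain ⟨T₀, hT₀, h⟩ := exists_liesOver_of_apply_one hψ hχ h1
      have h' := h.congr fun X hX => (hpp T₀ X hX).symm
      obtain ⟨S, hS0, rfl⟩ :=
        (hbase _ (hcube T₀ hT₀)).exists_twist_eq hψ (hcube T₀ hT₀) h'
      -- `T₀ ∘ₗ p + S` splits back under `p` into its two summands, so `g` sends it to the given
      -- character.
      have hSp : S ∘ₗ p = 0 := LinearMap.ext fun X => hS0 _ (hp_mem X)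
      have hTp : (T₀ ∘ₗ p) ∘ₗ p = T₀ ∘ₗ p :=
        LinearMap.ext fun X => congrArg T₀ (hp _ (hp_mem X))
      have hT : ∀ X ∈ patternCube F D, (T₀ ∘ₗ p + S) X = 0 := fun X hX => by
        rw [LinearMap.add_apply, hcube T₀ hT₀ X hX, hS0 X (patternCube_le_patternSquare hX),
          add_zero]
      have hgT : g (T₀ ∘ₗ p + S) = fun x => ψ (S (oneAdd.symm x)) * base (T₀ ∘ₗ p) x := by
        simp only [g, LinearMap.add_comp, hSp, hTp, add_zero, add_sub_cancel_left]
      refine ⟨T₀ ∘ₗ p + S, (hdeg hT (hg hT)).1 ?_, hgT⟩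
      rw [hgT]
      exact h1
    · rintro ⟨T, hT, rfl⟩
      exact ⟨(hg (hs hT)).isIrreducibleCharacter, (hdeg (hs hT) (hg (hs hT))).2 hT⟩
  have horb : {O : Set (Dual F (patternAlgebra F D)) |
      (∃ T, O = coadjointOrbit T) ∧ O.encard = (Fintype.card F ^ 2 : ℕ)} =
      coadjointOrbit '' s := by
    ext O
    constructor
    · rintro ⟨⟨T, rfl⟩, hT⟩
      exact ⟨T, hT, rfl⟩
    · rintro ⟨T, hT, rfl⟩
      exact ⟨⟨T, rfl⟩, hT⟩
  rw [hchar, horb]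
  refine Set.encard_image_eq_encard_image_of_iff s _ _ fun T hT T' hT' => ?_
  rw [coadjointOrbit_eq_iff (hs hT)]
  have hle := patternSquare_le_bracketRadical (hs hT)
  have key (h : T ∘ₗ p = T' ∘ₗ p) :
      g T = g T' ↔ ∀ Y ∈ bracketRadical T, T Y = T' Y := by
    have := (hbase _ (hcube T (hs hT))).twist_eq_twist_iff hψ (hcube T (hs hT))
      (T - T ∘ₗ p) (T' - T' ∘ₗ p)
    rw [hrad] at this
    simp only [g]
    rw [← h] at this ⊢
    rw [this]
    simp only [LinearMap.sub_apply, sub_left_inj]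
  constructor
  · intro h
    -- Equal characters determine the same functional on the square, hence the same base character;
    -- conversely, equal orbits force agreement on the radical, which contains the square.
    have h' := (hg (hs hT)).unique hψ (h ▸ hg (hs hT'))
    exact (key (LinearMap.ext fun X => h' _ (hp_mem X))).1 h
  · intro h
    exact (key (LinearMap.ext fun X => h _ (hle (hp_mem X)))).2 h
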